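/- Let $p$ be a prime, $f\ge 1$ an integer, $q=p^f$. Let $\mathbb C_p$ be the completion of an algebraic closure of $\mathbb Q_p$, with valuation $v_p$ and absolute value $|x|=p^{-v_p(x)}$, so that $v_p(p)=1$. Let $\mathbb Q_q\subset\mathbb C_p$ be the unramified extension of $\mathbb Q_p$ of degree $f$, and $\mathbb Z_q$ its ring of integers. Let $\Psi_q\in T+T^2\mathbb Z[[T]]$ be the unique power series in $T+T^2\mathbb Z[[T]]$ such that $$\sum_{j=0}^{\infty}p^{-j}\,\Psi_q(p^jT)^{q^j}=T .$$ Then $\Psi_q$ converges on all of $\mathbb C_p$, and the following hold. 1. For every $n\ge 1$ the function $\Psi_q$ has exactly $q_n:=q^n-q^{n-1}$ zeros of valuation $-n$ in $\mathbb C_p$; they are all simple and all lie in $\mathbb Q_q$. For every unit $a$ of $\mathbb Z_q$ the open disc $D(ap^{-n},p^-)=\{x\in\mathbb C_p : |x-ap^{-n}|<p\}$ contains exactly one zero of $\Psi_q$, and this zero lies in $\mathbb Q_q$. If $a_1,\dots,a_{q_n}\in\mathbb Z_q$ is any system of representatives of $(\mathbb Z_q/p^n\mathbb Z_q)^\times$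 and $z_i$ is the unique zero of $\Psi_q$ in $D(a_ip^{-n},p^-)$, then $z_1,\dots,z_{q_n}$ are distinct and are all the zeros of $\Psi_q$ of valuation $-n$. 2. For $n\ge1$ let $z^{(n)}_1,\dots,z^{(n)}_{q_n}$ be the zeros of $\Psi_q$ of valuation $-n$, and put $\psi_n(x)=\prod_{i=1}^{q_n}\bigl(1-x/z^{(n)}_i\bigr)$. Then $\psi_n\in 1+p^nx\,\mathbb Z_q[x]$, and $$\Psi_q(x)=x\prod_{n=1}^\infty\psi_n(x)$$ is the Lazard–Schnirelmann product of $\Psi_q$ in the ring $\mathbb Q_p\{x\}$ of entire functions over $\mathbb Q_p$. That is, each $\psi_n$ lies in $\mathbb Q_p[x]$, has constant term $1$ and is $(-n)$-extremal (for $\psi_n=\sum_{i\le d}c_ix^i$ of degree $d$, $v_p(c_i)-in\ge v_p(c_0)$ for all $i$, with equality for $i=d$), and the product converges to $\Psi_q$ uniformly on every bounded disc of $\mathbb C_p$. 3. There is exactly one $\beta_q\in T\mathbb Z[[T]]$ with $\Psi_q(\beta_q(T))=T=\beta_q(\Psi_q(T))$. It belongs to $T+T^2\mathbb Z[[T]]$,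 and for $T\in\mathbb C_p$ the series $\beta_q(T)$ converges if and only if $v_p(T)>-1$. -/

import Mathlib

open scoped PowerSeries Polynomial

/-- `Ψ ∈ T + T² ℤ⟦T⟧` and `∑_{j ≥ 0} p^{-j} Ψ(p^j T)^{q^j} = T`, coefficient by coefficient. (For each
exponent `k` only the terms with `q^j ≤ k` contribute, so the sum is the `T`-adically convergent one.) -/
def IsPsi (p q : ℕ) (Ψ : ℤ⟦X⟧) : Prop :=
  PowerSeries.coeff 0 Ψ = 0 ∧ PowerSeries.coeff 1 Ψ = 1 ∧
  ∀ k : ℕ, HasSum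
    (fun j : ℕ => ((p : ℚ) ^ j)⁻¹ * PowerSeries.coeff k
      ((PowerSeries.rescale ((p : ℚ) ^ j) (Ψ.map (Int.castRingHom ℚ))) ^ (q ^ j)))
    (PowerSeries.coeff k (PowerSeries.X : ℚ⟦X⟧))

/-- The map `φ ↦ T - ∑_{j ≥ 1} p^{-j} φ(p^j T)^{q^j}` on `T ℤ⟦T⟧`: the coefficient of `T^k` in
`p^{-j} φ(p^j T)^{q^j}` is `p^{j(k-1)}` times that of `φ^{q^j}`, and it vanishes for `j > k`. -/
noncomputable def psiStep (p q : ℕ) (φ : ℤ⟦X⟧) : ℤ⟦X⟧ :=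
  PowerSeries.mk fun k => PowerSeries.coeff k (PowerSeries.X : ℤ⟦X⟧) -
    ∑ j ∈ Finset.Icc 1 k, (p : ℤ) ^ (j * (k - 1)) * PowerSeries.coeff k (φ ^ (q ^ j))

/-- The series `Ψ_q`, as the `T`-adic limit of the iterates of `psiStep` starting from `T`.
By `isPsi_psi` and `IsPsi.eq_psi` it is the unique solution of the functional equation. -/
noncomputable def psi (p q : ℕ) : ℤ⟦X⟧ :=
  PowerSeries.mk fun k => PowerSeries.coeff k ((psiStep p q)^[k] PowerSeries.X)

theorem coeff_pow_congr {φ χ : ℤ⟦X⟧} (hφ : PowerSeries.coeff 0 φ = 0)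
    (hχ : PowerSeries.coeff 0 χ = 0) {m : ℕ}
    (h : ∀ i < m, PowerSeries.coeff i φ = PowerSeries.coeff i χ) {N : ℕ} (hN : 2 ≤ N) :
    ∀ i < m + 1, PowerSeries.coeff i (φ ^ N) = PowerSeries.coeff i (χ ^ N) := by
  have h1 : (PowerSeries.X : ℤ⟦X⟧) ^ m ∣ φ - χ := by
    rw [PowerSeries.X_pow_dvd_iff]
    intro i hi
    rw [map_sub, h i hi, sub_self]
  have hφ' : (PowerSeries.X : ℤ⟦X⟧) ∣ φ := by
    rw [PowerSeries.X_dvd_iff, ← PowerSeries.coeff_zero_eq_constantCoeff_apply]; exact hφ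
  have hχ' : (PowerSeries.X : ℤ⟦X⟧) ∣ χ := by
    rw [PowerSeries.X_dvd_iff, ← PowerSeries.coeff_zero_eq_constantCoeff_apply]; exact hχ
  have h2 : (PowerSeries.X : ℤ⟦X⟧) ∣ ∑ i ∈ Finset.range N, φ ^ i * χ ^ (N - 1 - i) := by
    refine Finset.dvd_sum fun i hi => ?_
    rcases Nat.eq_zero_or_pos i with rfl | hi0
    · exact Dvd.dvd.mul_left (hχ'.trans (dvd_pow_self _ (by omega))) _
    · exact Dvd.dvd.mul_right (hφ'.trans (dvd_pow_self _ (by omega))) _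
  have h3 : (PowerSeries.X : ℤ⟦X⟧) ^ (m + 1) ∣ φ ^ N - χ ^ N := by
    rw [← geom_sum₂_mul, pow_succ, mul_comm]
    exact mul_dvd_mul h2 h1 |>.trans (by rw [mul_comm])
  intro i hi
  have := (PowerSeries.X_pow_dvd_iff.mp h3) i hi
  rwa [map_sub, sub_eq_zero] at this

theorem psiStep_congr (p : ℕ) {q : ℕ} (hq : 2 ≤ q) {φ χ : ℤ⟦X⟧} (hφ : PowerSeries.coeff 0 φ = 0)
    (hχ : PowerSeries.coeff 0 χ = 0) {m : ℕ}
    (h : ∀ i < m, PowerSeries.coeff i φ = PowerSeries.coeff i χ) :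
    ∀ i < m + 1, PowerSeries.coeff i (psiStep p q φ) = PowerSeries.coeff i (psiStep p q χ) := by
  intro i hi
  simp only [psiStep, PowerSeries.coeff_mk]
  congr 1
  refine Finset.sum_congr rfl fun j hj => ?_
  have hj1 : 1 ≤ j := (Finset.mem_Icc.mp hj).1
  have : 2 ≤ q ^ j := hq.trans (Nat.le_self_pow (by omega) q)
  rw [coeff_pow_congr hφ hχ h this i hi]

theorem coeff_zero_psiStep (p q : ℕ) (φ : ℤ⟦X⟧) : PowerSeries.coeff 0 (psiStep p q φ) = 0 := by
  simp [psiStep]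

theorem coeff_zero_iterate (p q m : ℕ) :
    PowerSeries.coeff 0 ((psiStep p q)^[m] PowerSeries.X) = 0 := by
  cases m with
  | zero => simp
  | succ m => rw [Function.iterate_succ_apply']; exact coeff_zero_psiStep _ _ _

theorem coeff_iterate_succ (p : ℕ) {q : ℕ} (hq : 2 ≤ q) (m : ℕ) :
    ∀ i < m + 1, PowerSeries.coeff i ((psiStep p q)^[m + 1] PowerSeries.X) =
      PowerSeries.coeff i ((psiStep p q)^[m] PowerSeries.X) := by
  induction m with
  | zero =>
    intro i hi
    obtain rfl : i = 0 := by omega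
    rw [coeff_zero_iterate, coeff_zero_iterate]
  | succ m ih =>
    rw [Function.iterate_succ_apply' _ (m + 1), Function.iterate_succ_apply' _ m]
    exact psiStep_congr p hq (by rw [← Function.iterate_succ_apply' (psiStep p q)]; exact coeff_zero_iterate _ _ _)
      (coeff_zero_iterate _ _ _) (by rw [← Function.iterate_succ_apply' (psiStep p q)]; exact ih)

theorem coeff_psi (p : ℕ) {q : ℕ} (hq : 2 ≤ q) (m : ℕ) :
    ∀ i < m + 1, PowerSeries.coeff i (psi p q) =
      PowerSeries.coeff i ((psiStep p q)^[m] PowerSeries.X) := by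
  intro i hi
  rw [psi, PowerSeries.coeff_mk]
  obtain ⟨d, rfl⟩ := Nat.exists_eq_add_of_le (Nat.lt_succ_iff.mp hi)
  clear hi
  induction d with
  | zero => rfl
  | succ d ih => rw [ih, ← add_assoc, coeff_iterate_succ p hq (i + d) i (by omega)]

theorem psiStep_psi (p : ℕ) {q : ℕ} (hq : 2 ≤ q) : psiStep p q (psi p q) = psi p q := by
  ext i
  rw [psiStep_congr p hq (χ := (psiStep p q)^[i] PowerSeries.X)
    (by rw [coeff_psi p hq 0 0 (by omega), coeff_zero_iterate]) (coeff_zero_iterate _ _ _)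
    (fun l hl => coeff_psi p hq i l (by omega)) (m := i) i (by omega),
    ← Function.iterate_succ_apply' (psiStep p q), coeff_psi p hq (i + 1) i (by omega)]

/-- The solutions of the functional equation are the fixed points of `psiStep`. -/
theorem isPsi_iff {p q : ℕ} (hp : p ≠ 0) (hq : 2 ≤ q) (Ψ : ℤ⟦X⟧) :
    IsPsi p q Ψ ↔ psiStep p q Ψ = Ψ := by
  have hp' : (p : ℚ) ≠ 0 := by exact_mod_cast hp
  have vanish : ∀ Ψ : ℤ⟦X⟧, PowerSeries.coeff 0 Ψ = 0 → ∀ k N : ℕ, k < N →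
      PowerSeries.coeff k (Ψ ^ N) = 0 := by
    intro Ψ h0 k N hkN
    have hX : (PowerSeries.X : ℤ⟦X⟧) ∣ Ψ := by
      rw [PowerSeries.X_dvd_iff, ← PowerSeries.coeff_zero_eq_constantCoeff_apply]; exact h0
    exact PowerSeries.X_pow_dvd_iff.mp (pow_dvd_pow_of_dvd hX N) k hkN
  have term : ∀ (Ψ : ℤ⟦X⟧) (k j : ℕ), PowerSeries.coeff k
      ((PowerSeries.rescale ((p : ℚ) ^ j) (Ψ.map (Int.castRingHom ℚ))) ^ (q ^ j)) =
      ((p : ℚ) ^ j) ^ k * (PowerSeries.coeff k (Ψ ^ (q ^ j)) : ℤ) := by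
    intro Ψ k j
    rw [← map_pow, PowerSeries.coeff_rescale, ← map_pow, PowerSeries.coeff_map]
    simp
  have key : ∀ Ψ : ℤ⟦X⟧, PowerSeries.coeff 0 Ψ = 0 → ∀ k : ℕ, (HasSum
    (fun j : ℕ => ((p : ℚ) ^ j)⁻¹ * PowerSeries.coeff k
      ((PowerSeries.rescale ((p : ℚ) ^ j) (Ψ.map (Int.castRingHom ℚ))) ^ (q ^ j)))
    (PowerSeries.coeff k (PowerSeries.X : ℚ⟦X⟧)) ↔
      PowerSeries.coeff k (psiStep p q Ψ) = PowerSeries.coeff k Ψ) := by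
    intro Ψ h0 k
    rcases Nat.eq_zero_or_pos k with rfl | hk
    · rw [coeff_zero_psiStep, h0]
      simp only [iff_true, term]
      have : ∀ j : ℕ, PowerSeries.coeff 0 (Ψ ^ (q ^ j)) = 0 := fun j =>
        vanish Ψ h0 _ _ (by positivity)
      simp [this, hasSum_zero]
    · have hs : HasSum (fun j : ℕ => ((p : ℚ) ^ j)⁻¹ * PowerSeries.coeff k
          ((PowerSeries.rescale ((p : ℚ) ^ j) (Ψ.map (Int.castRingHom ℚ))) ^ (q ^ j)))
          (∑ j ∈ Finset.range (k + 1), ((p : ℚ) ^ j)⁻¹ * PowerSeries.coeff k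
          ((PowerSeries.rescale ((p : ℚ) ^ j) (Ψ.map (Int.castRingHom ℚ))) ^ (q ^ j))) := by
        refine hasSum_sum_of_ne_finset_zero fun j hj => ?_
        have hj' : k < j := by simpa using hj
        rw [term, vanish Ψ h0 _ _ (hj'.trans (Nat.lt_pow_self (by omega)))]
        simp
      have hsum : (∑ j ∈ Finset.range (k + 1), ((p : ℚ) ^ j)⁻¹ * PowerSeries.coeff k
          ((PowerSeries.rescale ((p : ℚ) ^ j) (Ψ.map (Int.castRingHom ℚ))) ^ (q ^ j))) =
          ((PowerSeries.coeff k Ψ + ∑ j ∈ Finset.Icc 1 k,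
            (p : ℤ) ^ (j * (k - 1)) * PowerSeries.coeff k (Ψ ^ (q ^ j)) : ℤ) : ℚ) := by
        rw [Finset.range_eq_Ico, Finset.sum_eq_sum_Ico_succ_bot (by omega)]
        push_cast
        congr 1
        · rw [term]; simp
        · refine Finset.sum_congr (by ext; simp) fun j hj => ?_
          rw [term, ← mul_assoc]
          congr 1
          obtain ⟨k, rfl⟩ := Nat.exists_eq_add_of_le hk
          simp only [Nat.add_sub_cancel_left, pow_mul, pow_add, pow_one]
          field_simp
      have hX : PowerSeries.coeff k (PowerSeries.X : ℚ⟦X⟧) =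
          ((PowerSeries.coeff k (PowerSeries.X : ℤ⟦X⟧) : ℤ) : ℚ) := by
        simp [PowerSeries.coeff_X]
      rw [psiStep, PowerSeries.coeff_mk, sub_eq_iff_eq_add]
      constructor
      · intro h
        have := h.unique hs
        rw [hsum, hX] at this
        exact_mod_cast this
      · intro h
        rw [hX, h, ← hsum]
        exact hs
  constructor
  · rintro ⟨h0, -, h⟩
    ext k
    exact (key Ψ h0 k).mp (h k)
  · intro h
    have h0 : PowerSeries.coeff 0 Ψ = 0 := by rw [← h, coeff_zero_psiStep]
    refine ⟨h0, ?_, fun k => (key Ψ h0 k).mpr (by rw [h])⟩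
    rw [← h, psiStep, PowerSeries.coeff_mk]
    have : PowerSeries.coeff 1 (Ψ ^ q) = 0 := vanish Ψ h0 1 q (by omega)
    simp [this]

theorem isPsi_psi {p q : ℕ} (hp : p ≠ 0) (hq : 2 ≤ q) : IsPsi p q (psi p q) :=
  (isPsi_iff hp hq _).mpr (psiStep_psi p hq)

theorem IsPsi.eq_psi {p q : ℕ} (hp : p ≠ 0) (hq : 2 ≤ q) {Ψ : ℤ⟦X⟧} (h : IsPsi p q Ψ) :
    Ψ = psi p q := by
  have h1 := (isPsi_iff hp hq _).mp h
  have h2 := psiStep_psi p hq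
  have h3 := isPsi_psi hp hq
  have : ∀ m : ℕ, ∀ i < m, PowerSeries.coeff i Ψ = PowerSeries.coeff i (psi p q) := by
    intro m
    induction m with
    | zero => intro i hi; omega
    | succ m ih =>
      intro i hi
      rw [← h1, ← h2]
      exact psiStep_congr p hq h.1 h3.1 ih i hi
  ext i
  exact this (i + 1) i (by omega)

/-- The unramified extension `ℚ_q` of `ℚ_p` of degree `f` inside `ℂ_p`, `q = p ^ f`: it is generated
by the roots of unity of order dividing `q - 1`. -/
noncomputable def Qq (p : ℕ) [Fact p.Prime] (f : ℕ) : IntermediateField ℚ_[p] ℂ_[p] :=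
  IntermediateField.adjoin ℚ_[p] {ζ : ℂ_[p] | ζ ^ (p ^ f - 1) = 1}

/-- The ring of integers `ℤ_q` of `ℚ_q`. -/
noncomputable def Zq (p : ℕ) [Fact p.Prime] (f : ℕ) : Subring ℂ_[p] where
  carrier := {x | x ∈ Qq p f ∧ ‖x‖ ≤ 1}
  mul_mem' := fun ha hb => ⟨mul_mem ha.1 hb.1, by
    rw [norm_mul]; exact mul_le_one₀ ha.2 (norm_nonneg _) hb.2⟩
  one_mem' := ⟨one_mem _, by simp⟩
  add_mem' := fun ha hb => ⟨add_mem ha.1 hb.1,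
    (PadicComplex.isNonarchimedean p _ _).trans (max_le ha.2 hb.2)⟩
  zero_mem' := ⟨zero_mem _, by simp⟩
  neg_mem' := fun ha => ⟨neg_mem ha.1, by simpa using ha.2⟩

/-- The `a i` are a system of representatives of the group of units of `ℤ_q / p^n ℤ_q`. -/
def IsUnitRepresentatives (p : ℕ) [Fact p.Prime] (f n : ℕ) {ι : Type*} (a : ι → Zq p f) : Prop :=
  Set.BijOn (fun i => Ideal.Quotient.mk (Ideal.span {(p : Zq p f) ^ n}) (a i)) Set.univ
    {u | IsUnit u}

/-- The value of a power series at a point of `ℂ_p` (meaningful where the series converges). -/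
noncomputable def evalCp {p : ℕ} [Fact p.Prime] (F : ℂ_[p]⟦X⟧) (x : ℂ_[p]) : ℂ_[p] :=
  ∑' k : ℕ, PowerSeries.coeff k F * x ^ k

/-- `F` is entire on `ℂ_p`. -/
def IsEntire {p : ℕ} [Fact p.Prime] (F : ℂ_[p]⟦X⟧) : Prop :=
  ∀ x : ℂ_[p], Summable fun k : ℕ => PowerSeries.coeff k F * x ^ k

/-- A simple zero: `F(z) = 0` and `F'(z) ≠ 0`. -/
def IsSimpleZero {p : ℕ} [Fact p.Prime] (F : ℂ_[p]⟦X⟧) (z : ℂ_[p]) : Prop :=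
  evalCp F z = 0 ∧ evalCp (PowerSeries.derivative ℂ_[p] F) z ≠ 0

/-- `Ψ_q` with `q = p ^ f`, as a power series with coefficients in `ℂ_p`. -/
noncomputable def psiCp (p : ℕ) [Fact p.Prime] (f : ℕ) : ℂ_[p]⟦X⟧ :=
  (psi p (p ^ f)).map (Int.castRingHom ℂ_[p])

/-- The zeros of `Ψ_q` in `ℂ_p` of valuation `-n`, i.e. of absolute value `p ^ n`. -/
def psiZeros (p : ℕ) [Fact p.Prime] (f n : ℕ) : Set ℂ_[p] :=
  {z | ‖z‖ = (p : ℝ) ^ n ∧ evalCp (psiCp p f) z = 0}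

/-- `ψ_n = ∏_z (1 - x / z)`, over the (finitely many) zeros `z` of `Ψ_q` of valuation `-n`. -/
noncomputable def psiFactor (p : ℕ) [Fact p.Prime] (f n : ℕ) : ℂ_[p][X] :=
  ∏ᶠ z ∈ psiZeros p f n, (1 - Polynomial.C z⁻¹ * Polynomial.X)

/-- `P` is extremal for the radius `ρ = p ^ (-μ)` (`μ`-extremal): its constant term and its leading
term are both dominant on `|x| = ρ`. Equivalently, all its zeros in `ℂ_p` have absolute value `ρ`. -/
def IsExtremal {p : ℕ} [Fact p.Prime] (P : ℚ_[p][X]) (ρ : ℝ) : Prop :=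
  P ≠ 0 ∧ (∀ i : ℕ, ‖P.coeff i‖ * ρ ^ i ≤ ‖P.coeff 0‖) ∧
    ‖P.leadingCoeff‖ * ρ ^ P.natDegree = ‖P.coeff 0‖

/-- `F = c x^m ∏_{n ≥ 1} P n` is the Lazard–Schnirelmann product of the entire series `F` over `ℚ_p`:
each `P n ∈ 1 + x ℚ_p[x]` is extremal for the radius `ρ n`, the radii increase strictly, and the
product converges in `ℚ_p{x}`, i.e. uniformly on every ball of `ℂ_p` (unconditionally). -/
structure IsSchnirelmannProduct {p : ℕ} [Fact p.Prime] (F : ℚ_[p]⟦X⟧) (c : ℚ_[p]) (m : ℕ)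
    (P : ℕ+ → ℚ_[p][X]) (ρ : ℕ+ → ℝ) : Prop where
  entire : IsEntire (F.map (algebraMap ℚ_[p] ℂ_[p]))
  radius_pos : ∀ n, 0 < ρ n
  radius_strictMono : StrictMono ρ
  coeff_zero : ∀ n, (P n).coeff 0 = 1
  extremal : ∀ n, IsExtremal (P n) (ρ n)
  tendsto : ∀ R : ℝ, TendstoUniformlyOn
    (fun (s : Finset ℕ+) (x : ℂ_[p]) =>
      algebraMap ℚ_[p] ℂ_[p] c * x ^ m * ∏ n ∈ s, Polynomial.aeval x (P n))
    (evalCp (F.map (algebraMap ℚ_[p] ℂ_[p]))) Filter.atTop (Metric.closedBall 0 R)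

/-!
The functional equation `Ψ(x) = x - ∑_{j ≥ 1} p⁻ʲ Ψ(pʲ x) ^ qʲ` determines `Ψ = Ψ_q` at `x` from its
values at the smaller points `pʲ x`, and everything is deduced from it.

*Growth.* It bounds the Gauss norm of `Ψ` on the disc of radius `p ^ m` by that on smaller discs; so
`Ψ` is entire with Gauss norm at most `p ^ (1 + q + ⋯ + q ^ (m - 1))` there (`gaussNormLE_psiCp`).

*Behaviour near `ℚ_q`.* On `ℤ_q = ℤ_p[μ_{q-1}]` one has `u ^ q ≡ u` modulo `p`
(`norm_pow_sub_self_le`). Comparing the functional equation at `x` and at `p x` gives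
`Ψ(x) = ∑_{j ≥ 1} p⁻ʲ (uⱼ ^ q ^ (j - 1) - uⱼ ^ qʲ)` with `uⱼ = Ψ(pʲ x)`, so that inductively `Ψ` maps
`ℚ_q` to `ℤ_q`. As `q`-power maps contract the unit disc, `y ↦ y - Ψ(y)` is a contraction near every
point of `ℚ_q` (`psi_near_Qq_aux`). Its fixed point is a zero of `Ψ` in `x + ℤ_q`, the only one in
the open disc of radius `p` around `x ∈ ℚ_q` (`exists_zero_near`, `eq_of_zeros_near`).

*All zeros.* This yields at least `q ^ n - q ^ (n - 1)` zeros of absolute value `p ^ n` for each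
`n ≥ 1`. Divide `Ψ` by `x` and by the linear factors of the zeros found up to absolute value `p ^ N`.
Each division by `1 - x / z` lowers the Gauss norm on the disc of radius `r = p ^ (N + 1)` by the
factor `‖z‖ / r`, and with the growth bound the cofactor `Q` has Gauss norm at most `1` there
(`exists_psi_eq_prod_mul`). Since `Q(0) = 1`, it follows that `‖Q(x) - 1‖ ≤ ‖x‖ / r`. Hence `Q` has no
zeros in the open disc, so that no zero was missed and all are simple, and `Q → 1` uniformly on
bounded discs, which is the convergence of the product. The factors have coefficients in `ℚ_p` because
the automorphisms of `ℚ_q` are continuous and so permute the zeros.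

*The inverse.* The series `G(T) = p Ψ(T / p)` is integral and congruent to `T - T ^ q` modulo `p`, and
`β(T) = p⁻¹ γ(p T)` with `γ` the inverse of `G`. So `β` converges for `‖T‖ < p`; convergence at a point
with `‖T‖ ≥ p` would make `γ` modulo `p` a polynomial with `γ - γ ^ q = T`, which is impossible for
reasons of degree (`summable_inverse_iff`).
-/

/-! ### Power series over `ℂ_p` and their Gauss norms -/

section Entire

variable {p : ℕ} [Fact p.Prime]

/-- The Gauss norm of `F` on the disc of radius `r` is at most `M`. -/
def GaussNormLE (F : ℂ_[p]⟦X⟧) (r M : ℝ) : Prop :=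
  ∀ k : ℕ, ‖PowerSeries.coeff k F‖ * r ^ k ≤ M

namespace GaussNormLE

variable {F G : ℂ_[p]⟦X⟧} {r s M N : ℝ} {x : ℂ_[p]}

theorem nonneg (h : GaussNormLE F r M) : 0 ≤ M :=
  le_trans (by simp) (h 0)

theorem norm_term_le (h : GaussNormLE F r M) (hr : 0 < r) (x : ℂ_[p]) (k : ℕ) :
    ‖PowerSeries.coeff k F * x ^ k‖ ≤ M * (‖x‖ / r) ^ k := by
  have h1 : ‖PowerSeries.coeff k F * x ^ k‖ =
      (‖PowerSeries.coeff k F‖ * r ^ k) * (‖x‖ / r) ^ k := by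
    rw [norm_mul, norm_pow, div_pow]
    field_simp
  rw [h1]
  exact mul_le_mul_of_nonneg_right (h k) (by positivity)

theorem summable_norm (h : GaussNormLE F r M) (hx : ‖x‖ < r) :
    Summable fun k : ℕ => ‖PowerSeries.coeff k F * x ^ k‖ := by
  have hr : 0 < r := (norm_nonneg x).trans_lt hx
  refine Summable.of_nonneg_of_le (fun k => norm_nonneg _) (h.norm_term_le hr x) ?_
  exact (summable_geometric_of_lt_one (by positivity) ((div_lt_one hr).mpr hx)).mul_left M

theorem norm_evalCp_le (h : GaussNormLE F r M) (hx : ‖x‖ ≤ r) : ‖evalCp F x‖ ≤ M := by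
  refine IsUltrametricDist.norm_tsum_le_of_forall_le fun k => ?_
  rw [norm_mul, norm_pow]
  exact le_trans (by gcongr) (h k)

theorem mul (hF : GaussNormLE F r M) (hG : GaussNormLE G r N) (hr : 0 < r) :
    GaussNormLE (F * G) r (M * N) := by
  intro k
  rw [PowerSeries.coeff_mul]
  have hM := hF.nonneg
  have hN := hG.nonneg
  rw [← le_div_iff₀ (by positivity)]
  refine IsUltrametricDist.norm_sum_le_of_forall_le_of_nonneg (by positivity) fun ij hij => ?_
  rw [le_div_iff₀ (by positivity), ← Finset.HasAntidiagonal.mem_antidiagonal.mp hij, norm_mul, pow_add]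
  calc _ = (‖PowerSeries.coeff ij.1 F‖ * r ^ ij.1) * (‖PowerSeries.coeff ij.2 G‖ * r ^ ij.2) := by
        ring
    _ ≤ M * N := mul_le_mul (hF _) (hG _) (by positivity) hM

theorem one : GaussNormLE (1 : ℂ_[p]⟦X⟧) r 1 := by
  intro k
  rcases Nat.eq_zero_or_pos k with rfl | hk
  · simp
  · simp [PowerSeries.coeff_one, hk.ne']

theorem pow (h : GaussNormLE F r M) (hr : 0 < r) (n : ℕ) : GaussNormLE (F ^ n) r (M ^ n) := by
  induction n with
  | zero => simpa using one
  | succ n ih => rw [pow_succ, pow_succ]; exact ih.mul h hr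

theorem mono_radius (h : GaussNormLE F r M) (hs : 0 ≤ s) (hsr : s ≤ r) : GaussNormLE F s M :=
  fun k => le_trans (by gcongr) (h k)

end GaussNormLE

namespace IsEntire

variable {F G : ℂ_[p]⟦X⟧}

theorem exists_gaussNormLE (hF : IsEntire F) (r : ℝ) : ∃ s M : ℝ, r < s ∧ 0 < s ∧
    GaussNormLE F s M := by
  have hp : 1 < (p : ℝ) := by exact_mod_cast (Fact.out : p.Prime).one_lt
  obtain ⟨m, hm⟩ := pow_unbounded_of_one_lt r hp
  have h1 := (hF ((p : ℂ_[p]) ^ m)⁻¹).tendsto_atTop_zero.norm.bddAbove_range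
  obtain ⟨M, hM⟩ := h1
  refine ⟨(p : ℝ) ^ m, M, hm, by positivity, fun k => ?_⟩
  have h2 := hM ⟨k, rfl⟩
  have h3 : ‖(p : ℂ_[p])‖ = (p : ℝ)⁻¹ := by
    have := PadicComplex.norm_extends' p (p : ℚ_[p])
    simpa using this
  simpa [h3] using h2

theorem of_gaussNormLE (h : ∀ r : ℝ, ∃ s M : ℝ, r < s ∧ GaussNormLE F s M) : IsEntire F := by
  intro x
  obtain ⟨s, M, hs, hM⟩ := h ‖x‖
  exact (hM.summable_norm hs).of_norm

theorem summable_norm (hF : IsEntire F) (x : ℂ_[p]) :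
    Summable fun k : ℕ => ‖PowerSeries.coeff k F * x ^ k‖ := by
  obtain ⟨s, M, hs, -, hM⟩ := hF.exists_gaussNormLE ‖x‖
  exact hM.summable_norm hs

theorem mul (hF : IsEntire F) (hG : IsEntire G) : IsEntire (F * G) := by
  refine of_gaussNormLE fun r => ?_
  obtain ⟨s, M, hs, hs0, hM⟩ := hF.exists_gaussNormLE r
  obtain ⟨t, N, ht, ht0, hN⟩ := hG.exists_gaussNormLE r
  refine ⟨min s t, M * N, lt_min hs ht, ?_⟩
  have h0 : 0 < min s t := lt_min hs0 ht0
  exact (hM.mono_radius h0.le (min_le_left _ _)).mul (hN.mono_radius h0.le (min_le_right _ _)) h0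

theorem coe (P : ℂ_[p][X]) : IsEntire (P : ℂ_[p]⟦X⟧) := by
  intro x
  refine summable_of_ne_finset_zero (s := Finset.range (P.natDegree + 1)) fun k hk => ?_
  rw [Polynomial.coeff_coe, Polynomial.coeff_eq_zero_of_natDegree_lt (by simpa using hk), zero_mul]

theorem one : IsEntire (1 : ℂ_[p]⟦X⟧) := by
  simpa using coe (1 : ℂ_[p][X])

theorem pow (hF : IsEntire F) (n : ℕ) : IsEntire (F ^ n) := by
  induction n with
  | zero => simpa using one
  | succ n ih => rw [pow_succ]; exact ih.mul hF

theorem evalCp_mul (hF : IsEntire F) (hG : IsEntire G) (x : ℂ_[p]) :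
    evalCp (F * G) x = evalCp F x * evalCp G x := by
  rw [evalCp, evalCp, evalCp, tsum_mul_tsum_eq_tsum_sum_antidiagonal_of_summable_norm
    (hF.summable_norm x) (hG.summable_norm x)]
  refine tsum_congr fun k => ?_
  rw [PowerSeries.coeff_mul, Finset.sum_mul]
  refine Finset.sum_congr rfl fun ij hij => ?_
  rw [← Finset.HasAntidiagonal.mem_antidiagonal.mp hij]
  ring

theorem evalCp_add (hF : IsEntire F) (hG : IsEntire G) (x : ℂ_[p]) :
    evalCp (F + G) x = evalCp F x + evalCp G x := by
  rw [evalCp, evalCp, evalCp, ← (hF x).tsum_add (hG x)]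
  exact tsum_congr fun k => by rw [map_add, add_mul]

end IsEntire

theorem evalCp_coe (P : ℂ_[p][X]) (x : ℂ_[p]) : evalCp (P : ℂ_[p]⟦X⟧) x = P.eval x := by
  rw [evalCp, tsum_eq_sum (s := Finset.range (P.natDegree + 1)), Polynomial.eval_eq_sum_range]
  · simp
  · intro k hk
    rw [Polynomial.coeff_coe, Polynomial.coeff_eq_zero_of_natDegree_lt (by simpa using hk),
      zero_mul]

theorem evalCp_one (x : ℂ_[p]) : evalCp (1 : ℂ_[p]⟦X⟧) x = 1 := by
  simpa using evalCp_coe (1 : ℂ_[p][X]) x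

theorem IsEntire.evalCp_pow {F : ℂ_[p]⟦X⟧} (hF : IsEntire F) (n : ℕ) (x : ℂ_[p]) :
    evalCp (F ^ n) x = evalCp F x ^ n := by
  induction n with
  | zero => simp [evalCp_one]
  | succ n ih => rw [pow_succ, (hF.pow n).evalCp_mul hF, ih, pow_succ]

theorem IsEntire.derivative {F : ℂ_[p]⟦X⟧} (hF : IsEntire F) :
    IsEntire (PowerSeries.derivative ℂ_[p] F) := by
  refine IsEntire.of_gaussNormLE fun r => ?_
  obtain ⟨s, M, hs, hs0, hM⟩ := hF.exists_gaussNormLE r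
  refine ⟨s, M / s, hs, fun k => ?_⟩
  rw [PowerSeries.coeff_derivative, le_div_iff₀ hs0, norm_mul, mul_assoc, ← pow_succ]
  have h1 : ‖((k : ℂ_[p]) + 1)‖ ≤ 1 := by
    exact_mod_cast IsUltrametricDist.norm_natCast_le_one ℂ_[p] (k + 1)
  calc _ ≤ ‖PowerSeries.coeff (k + 1) F‖ * 1 * s ^ (k + 1) := by gcongr
    _ ≤ M := by rw [mul_one]; exact hM (k + 1)

/-- Division of an entire series by a linear factor at a nonzero zero `z`. The Gauss norm of the
quotient on a disc of radius `r ≥ ‖z‖` is smaller by the factor `‖z‖ / r`: the `k`-th coefficient of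
the quotient is `z⁻ᵏ ∑_{i ≤ k} aᵢ zⁱ`, which is also `-z⁻ᵏ ∑_{i > k} aᵢ zⁱ`. -/
theorem IsEntire.exists_eq_linear_mul {F : ℂ_[p]⟦X⟧} (hF : IsEntire F) {z : ℂ_[p]} (hz : z ≠ 0)
    (h : evalCp F z = 0) :
    ∃ Q : ℂ_[p]⟦X⟧, F = ((1 - Polynomial.C z⁻¹ * Polynomial.X : ℂ_[p][X]) : ℂ_[p]⟦X⟧) * Q ∧
      IsEntire Q ∧ ∀ r M : ℝ, ‖z‖ ≤ r → GaussNormLE F r M → GaussNormLE Q r (M * (‖z‖ / r)) := by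
  have hz0 : 0 < ‖z‖ := norm_pos_iff.mpr hz
  set Q : ℂ_[p]⟦X⟧ := PowerSeries.mk fun k =>
    z⁻¹ ^ k * ∑ i ∈ Finset.range (k + 1), PowerSeries.coeff i F * z ^ i with hQ
  have key : ∀ r M : ℝ, ‖z‖ ≤ r → GaussNormLE F r M → GaussNormLE Q r (M * (‖z‖ / r)) := by
    intro r M hr hM k
    have hr0 : 0 < r := hz0.trans_le hr
    have hM0 := hM.nonneg
    have h1 := (hF z).sum_add_tsum_nat_add (k + 1)
    rw [← evalCp, h] at h1
    rw [hQ, PowerSeries.coeff_mk, eq_neg_of_add_eq_zero_left h1, norm_mul, norm_neg, norm_pow,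
      norm_inv]
    have h2 : ‖∑' i : ℕ, PowerSeries.coeff (i + (k + 1)) F * z ^ (i + (k + 1))‖ ≤
        M * (‖z‖ / r) ^ (k + 1) := by
      refine IsUltrametricDist.norm_tsum_le_of_forall_le fun i => ?_
      refine (hM.norm_term_le hr0 z _).trans ?_
      gcongr M * ?_
      exact pow_le_pow_of_le_one (by positivity) ((div_le_one hr0).mpr hr) (by omega)
    calc _ ≤ ‖z‖⁻¹ ^ k * (M * (‖z‖ / r) ^ (k + 1)) * r ^ k := by gcongr
      _ = (‖z‖⁻¹ * ‖z‖) ^ k * (r⁻¹ * r) ^ k * (M * (‖z‖ / r)) := by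
          rw [div_eq_mul_inv]
          ring
      _ = M * (‖z‖ / r) := by simp [hz0.ne', hr0.ne']
  refine ⟨Q, ?_, ?_, key⟩
  · ext k
    rw [Polynomial.coe_sub, Polynomial.coe_mul, Polynomial.coe_C, Polynomial.coe_X,
      Polynomial.coe_one, sub_mul, one_mul, map_sub, mul_assoc, PowerSeries.coeff_C_mul]
    cases k with
    | zero => simp [hQ]
    | succ k =>
      rw [PowerSeries.coeff_succ_X_mul, hQ, PowerSeries.coeff_mk, PowerSeries.coeff_mk,
        Finset.sum_range_succ _ (k + 1)]
      have h1 : z⁻¹ ^ (k + 1) * z ^ (k + 1) = 1 := by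
        rw [← mul_pow, inv_mul_cancel₀ hz, one_pow]
      linear_combination -(PowerSeries.coeff (k + 1) F) * h1
  · refine IsEntire.of_gaussNormLE fun r => ?_
    obtain ⟨s, M, hs, hs0, hM⟩ := hF.exists_gaussNormLE (max r ‖z‖)
    exact ⟨s, _, (le_max_left _ _).trans_lt hs, key s M ((le_max_right _ _).trans hs.le) hM⟩

theorem eval_prod_linear_eq_zero_iff {S : Finset ℂ_[p]} {x : ℂ_[p]} :
    (∏ z ∈ S, (1 - Polynomial.C z⁻¹ * Polynomial.X : ℂ_[p][X])).eval x = 0 ↔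
      ∃ z ∈ S, z⁻¹ * x = 1 := by
  rw [Polynomial.eval_prod, Finset.prod_eq_zero_iff]
  simp [sub_eq_zero, eq_comm (a := (1 : ℂ_[p]))]

/-- Division of an entire series by linear factors at finitely many distinct nonzero zeros. -/
theorem IsEntire.exists_eq_prod_linear_mul {F : ℂ_[p]⟦X⟧} (hF : IsEntire F) (S : Finset ℂ_[p])
    (hS : ∀ z ∈ S, z ≠ 0 ∧ evalCp F z = 0) :
    ∃ Q : ℂ_[p]⟦X⟧,
      F = ((∏ z ∈ S, (1 - Polynomial.C z⁻¹ * Polynomial.X) : ℂ_[p][X]) : ℂ_[p]⟦X⟧) * Q ∧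
      IsEntire Q ∧ ∀ r M : ℝ, (∀ z ∈ S, ‖z‖ ≤ r) → GaussNormLE F r M →
        GaussNormLE Q r (M * ∏ z ∈ S, (‖z‖ / r)) := by
  classical
  induction S using Finset.induction_on with
  | empty => exact ⟨F, by simp, hF, fun r M _ h => by simpa using h⟩
  | insert z S hzS ih =>
    obtain ⟨Q, hFQ, hQ, hb⟩ := ih fun w hw => hS w (Finset.mem_insert_of_mem hw)
    obtain ⟨hz, hFz⟩ := hS z (Finset.mem_insert_self _ _)
    have hQz : evalCp Q z = 0 := by
      rw [hFQ, (IsEntire.coe _).evalCp_mul hQ, evalCp_coe] at hFz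
      refine (mul_eq_zero.mp hFz).resolve_left fun h0 => ?_
      obtain ⟨w, hw, hwz⟩ := eval_prod_linear_eq_zero_iff.mp h0
      have hw0 : w ≠ 0 := (hS w (Finset.mem_insert_of_mem hw)).1
      have : z = w := by field_simp at hwz; exact hwz
      exact hzS (this ▸ hw)
    obtain ⟨Q', hQQ', hQ', hb'⟩ := hQ.exists_eq_linear_mul hz hQz
    refine ⟨Q', ?_, hQ', fun r M hr hM => ?_⟩
    · rw [Finset.prod_insert hzS, Polynomial.coe_mul, hFQ, hQQ']
      ring
    · rw [Finset.prod_insert hzS, mul_comm (‖z‖ / r), ← mul_assoc]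
      exact hb' r _ (hr z (Finset.mem_insert_self _ _))
        (hb r M (fun w hw => hr w (Finset.mem_insert_of_mem hw)) hM)

/-- A zero of an entire series that splits off a linear factor with cofactor not vanishing there
is simple. -/
theorem isSimpleZero_of_eq_linear_mul {F Q : ℂ_[p]⟦X⟧} {z : ℂ_[p]} (hz : z ≠ 0)
    (h : F = ((1 - Polynomial.C z⁻¹ * Polynomial.X : ℂ_[p][X]) : ℂ_[p]⟦X⟧) * Q)
    (hQ : IsEntire Q) (hQz : evalCp Q z ≠ 0) : IsSimpleZero F z := by
  have h1 : ((1 - Polynomial.C z⁻¹ * Polynomial.X : ℂ_[p][X])).eval z = 0 := by simp [hz]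
  constructor
  · rw [h, (IsEntire.coe _).evalCp_mul hQ, evalCp_coe, h1, zero_mul]
  · rw [h, Derivation.leibniz, smul_eq_mul, smul_eq_mul, PowerSeries.derivative_coe,
      ((IsEntire.coe _).mul hQ.derivative).evalCp_add (hQ.mul (IsEntire.coe _)),
      (IsEntire.coe _).evalCp_mul hQ.derivative, evalCp_coe, h1, zero_mul, zero_add,
      hQ.evalCp_mul (IsEntire.coe _), evalCp_coe]
    simp [hz, hQz]

end Entire

/-! ### The unramified extension `ℚ_q` -/

section Unramified

variable {p : ℕ} [Fact p.Prime] {f : ℕ}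

theorem norm_natCast_prime : ‖(p : ℂ_[p])‖ = (p : ℝ)⁻¹ := by
  simpa using PadicComplex.norm_extends' p (p : ℚ_[p])

theorem one_lt_prime_real : 1 < (p : ℝ) := by exact_mod_cast (Fact.out : p.Prime).one_lt

theorem prime_inv_lt_one : (p : ℝ)⁻¹ < 1 := inv_lt_one_of_one_lt₀ one_lt_prime_real

theorem natCast_prime_ne_zero : (p : ℂ_[p]) ≠ 0 := by
  exact_mod_cast (Fact.out : p.Prime).ne_zero

theorem two_le_prime_pow (hf : 0 < f) : 2 ≤ p ^ f :=
  (Fact.out : p.Prime).two_le.trans (Nat.le_self_pow hf.ne' p)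

theorem norm_sub_le_max' (x y : ℂ_[p]) : ‖x - y‖ ≤ max ‖x‖ ‖y‖ := by
  rw [sub_eq_add_neg, ← norm_neg y]
  exact IsUltrametricDist.norm_add_le_max _ _

/-- Raising to an exponent divisible by `p` contracts the unit disc:
`U ^ N - V ^ N = (U - V) (N V ^ (N - 1) + O(U - V))`. -/
theorem norm_pow_sub_pow_le {U V : ℂ_[p]} (hU : ‖U‖ ≤ 1) (hV : ‖V‖ ≤ 1) {N : ℕ} (hN : p ∣ N) :
    ‖U ^ N - V ^ N‖ ≤ max (p : ℝ)⁻¹ ‖U - V‖ * ‖U - V‖ := by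
  have key : ∀ i : ℕ, ‖U ^ i - V ^ i‖ ≤ ‖U - V‖ := fun i => by
    rw [← (Commute.all U V).geom_sum₂_mul, norm_mul]
    refine mul_le_of_le_one_left (norm_nonneg _) ?_
    refine IsUltrametricDist.norm_sum_le_of_forall_le_of_nonneg zero_le_one fun j _ => ?_
    rw [norm_mul, norm_pow, norm_pow]
    exact mul_le_one₀ (pow_le_one₀ (norm_nonneg _) hU) (by positivity)
      (pow_le_one₀ (norm_nonneg _) hV)
  rw [← (Commute.all U V).geom_sum₂_mul, norm_mul]
  refine mul_le_mul_of_nonneg_right ?_ (norm_nonneg _)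
  have h1 : ∑ i ∈ Finset.range N, U ^ i * V ^ (N - 1 - i) =
      ∑ i ∈ Finset.range N, (U ^ i - V ^ i) * V ^ (N - 1 - i) + N * V ^ (N - 1) := by
    have : (N : ℂ_[p]) * V ^ (N - 1) = ∑ i ∈ Finset.range N, V ^ i * V ^ (N - 1 - i) := by
      rw [Finset.sum_congr rfl (g := fun _ => V ^ (N - 1))]
      · simp
      · intro i hi
        rw [← pow_add, Nat.add_sub_cancel' (by have := Finset.mem_range.mp hi; omega)]
    rw [this, ← Finset.sum_add_distrib]
    exact Finset.sum_congr rfl fun i _ => by ring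
  rw [h1, max_comm]
  refine (IsUltrametricDist.norm_add_le_max _ _).trans (max_le_max ?_ ?_)
  · refine IsUltrametricDist.norm_sum_le_of_forall_le_of_nonneg (norm_nonneg _) fun i _ => ?_
    rw [norm_mul, norm_pow]
    exact (mul_le_of_le_one_right (norm_nonneg _) (pow_le_one₀ (norm_nonneg _) hV)).trans (key i)
  · obtain ⟨m, rfl⟩ := hN
    rw [norm_mul, norm_pow, Nat.cast_mul, norm_mul, norm_natCast_prime]
    refine (mul_le_of_le_one_right (by positivity) (pow_le_one₀ (norm_nonneg _) hV)).trans ?_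
    exact mul_le_of_le_one_right (by positivity) (IsUltrametricDist.norm_natCast_le_one _ _)

/-- `ℂ_p` as an algebra over the `p`-adic integers. -/
noncomputable instance padicIntAlgebraPadicComplex : Algebra ℤ_[p] ℂ_[p] :=
  ((algebraMap ℚ_[p] ℂ_[p]).comp (algebraMap ℤ_[p] ℚ_[p])).toAlgebra

theorem algebraMap_padicInt_apply (c : ℤ_[p]) :
    algebraMap ℤ_[p] ℂ_[p] c = algebraMap ℚ_[p] ℂ_[p] (c : ℚ_[p]) := rfl

theorem norm_algebraMap_padicInt (c : ℤ_[p]) : ‖algebraMap ℤ_[p] ℂ_[p] c‖ = ‖c‖ := by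
  rw [algebraMap_padicInt_apply, norm_algebraMap', PadicInt.norm_def]

/-- The order `ℤ_p[μ_{q-1}]`; it turns out to be all of `ℤ_q`. -/
noncomputable def rootsOrder (p : ℕ) [Fact p.Prime] (f : ℕ) : Subalgebra ℤ_[p] ℂ_[p] :=
  Algebra.adjoin ℤ_[p] {ζ : ℂ_[p] | ζ ^ (p ^ f - 1) = 1}

theorem norm_eq_one_of_pow_eq_one (hf : 0 < f) {ζ : ℂ_[p]} (h : ζ ^ (p ^ f - 1) = 1) :
    ‖ζ‖ = 1 := by
  have h1 : ‖ζ‖ ^ (p ^ f - 1) = 1 := by rw [← norm_pow, h, norm_one]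
  have := two_le_prime_pow (p := p) hf
  exact (pow_eq_one_iff_of_nonneg (norm_nonneg _) (by omega)).mp h1

theorem finite_roots (hf : 0 < f) : {ζ : ℂ_[p] | ζ ^ (p ^ f - 1) = 1}.Finite := by
  classical
  have := two_le_prime_pow (p := p) hf
  refine (Polynomial.nthRoots (p ^ f - 1) (1 : ℂ_[p])).toFinset.finite_toSet.subset fun ζ hζ => ?_
  simpa [Polynomial.mem_nthRoots (show 0 < p ^ f - 1 by omega)] using hζ

theorem isCompact_rootsOrder (hf : 0 < f) : IsCompact (rootsOrder p f : Set ℂ_[p]) := by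
  have hcl : (Submonoid.closure {ζ : ℂ_[p] | ζ ^ (p ^ f - 1) = 1} : Set ℂ_[p]) =
      {ζ : ℂ_[p] | ζ ^ (p ^ f - 1) = 1} := by
    refine Set.Subset.antisymm (fun x hx => ?_) Submonoid.subset_closure
    induction hx using Submonoid.closure_induction with
    | mem x hx => exact hx
    | one => simp
    | mul x y _ _ hx hy =>
      simp only [Set.mem_ofPred_eq] at hx hy ⊢
      rw [mul_pow, hx, hy, one_mul]
  have := (finite_roots (p := p) hf).fintype
  have h1 : (rootsOrder p f : Set ℂ_[p]) = Set.range (Fintype.linearCombination ℤ_[p]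
      (Subtype.val : {ζ : ℂ_[p] | ζ ^ (p ^ f - 1) = 1} → ℂ_[p])) := by
    rw [← LinearMap.coe_range, Fintype.range_linearCombination, Subtype.range_coe, ← hcl,
      ← Algebra.adjoin_eq_span]
    rfl
  rw [h1]
  refine isCompact_range ?_
  have h2 : Continuous (algebraMap ℤ_[p] ℂ_[p]) :=
    (continuous_algebraMap ℚ_[p] ℂ_[p]).comp continuous_subtype_val
  have h3 : ∀ c, Fintype.linearCombination ℤ_[p]
      (Subtype.val : {ζ : ℂ_[p] | ζ ^ (p ^ f - 1) = 1} → ℂ_[p]) c =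
      ∑ i, algebraMap ℤ_[p] ℂ_[p] (c i) * i.1 := fun c => by
    simp only [Fintype.linearCombination_apply, Algebra.smul_def]
  exact (continuous_congr h3).mpr (by fun_prop)

theorem rootsOrder_norm_le (hf : 0 < f) {x : ℂ_[p]} (hx : x ∈ rootsOrder p f) : ‖x‖ ≤ 1 := by
  induction hx using Algebra.adjoin_induction with
  | mem x hx => exact (norm_eq_one_of_pow_eq_one hf hx).le
  | algebraMap c => rw [norm_algebraMap_padicInt]; exact c.norm_le_one
  | add x y _ _ hx hy => exact (IsUltrametricDist.norm_add_le_max _ _).trans (max_le hx hy)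
  | mul x y _ _ hx hy => rw [norm_mul]; exact mul_le_one₀ hx (norm_nonneg _) hy

/-- The `q`-power map is the identity on `ℤ_p[μ_{q-1}]` modulo `p`: it is additive modulo `p`, and it
fixes `μ_{q-1}` and, modulo `p`, the elements of `ℤ_p`. -/
theorem exists_pow_sub_self_eq (hf : 0 < f) {x : ℂ_[p]} (hx : x ∈ rootsOrder p f) :
    ∃ r ∈ rootsOrder p f, x ^ p ^ f - x = p * r := by
  induction hx using Algebra.adjoin_induction with
  | mem x hx =>
    refine ⟨0, zero_mem _, ?_⟩
    have hx : x ^ (p ^ f - 1) = 1 := hx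
    have := two_le_prime_pow (p := p) hf
    rw [show p ^ f = p ^ f - 1 + 1 by omega, pow_succ, hx]
    simp
  | algebraMap c =>
    have h1 : (p : ℤ_[p]) ∣ c ^ p ^ f - c := by
      rw [← Ideal.mem_span_singleton, ← PadicInt.maximalIdeal_eq_span_p, ← PadicInt.ker_toZMod,
        RingHom.mem_ker, map_sub, map_pow, ZMod.pow_card_pow, sub_self]
    obtain ⟨d, hd⟩ := h1
    refine ⟨algebraMap ℤ_[p] ℂ_[p] d, Subalgebra.algebraMap_mem _ _, ?_⟩
    rw [← map_pow, ← map_sub, hd, map_mul, map_natCast]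
  | add x y hx hy hx' hy' =>
    obtain ⟨r, hr, hxr⟩ := hx'
    obtain ⟨s, hs, hys⟩ := hy'
    obtain ⟨t, ht⟩ := exists_add_pow_prime_pow_eq (Fact.out : p.Prime)
      (⟨x, hx⟩ : rootsOrder p f) ⟨y, hy⟩ f
    have ht' : (x + y) ^ p ^ f = x ^ p ^ f + y ^ p ^ f + p * x * y * t := congrArg Subtype.val ht
    refine ⟨r + s + x * y * t, add_mem (add_mem hr hs) (mul_mem (mul_mem hx hy) t.2), ?_⟩
    rw [ht']
    linear_combination hxr + hys
  | mul x y hx hy hx' hy' =>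
    obtain ⟨r, hr, hxr⟩ := hx'
    obtain ⟨s, hs, hys⟩ := hy'
    refine ⟨r * y ^ p ^ f + x * s, add_mem (mul_mem hr (pow_mem hy _)) (mul_mem hx hs), ?_⟩
    rw [mul_pow]
    linear_combination y ^ p ^ f * hxr + x * hys

/-- An element `r` of `ℤ_p[μ_{q-1}]` of norm less than one is divisible by `p` there, since
`r ^ q ^ k` is congruent to `r` modulo `p` and tends to zero. -/
theorem exists_eq_mul_of_norm_lt_one (hf : 0 < f) {x : ℂ_[p]} (hx : x ∈ rootsOrder p f)
    (h : ‖x‖ < 1) : ∃ r ∈ rootsOrder p f, x = p * r := by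
  have h2 := two_le_prime_pow (p := p) hf
  have hcl : IsClosed ((fun r : ℂ_[p] => (p : ℂ_[p]) * r) '' (rootsOrder p f : Set ℂ_[p])) :=
    ((isCompact_rootsOrder hf).image (by fun_prop)).isClosed
  have hk : ∀ k : ℕ, x - x ^ (p ^ f) ^ k ∈
      (fun r : ℂ_[p] => (p : ℂ_[p]) * r) '' (rootsOrder p f : Set ℂ_[p]) := by
    intro k
    induction k with
    | zero => exact ⟨0, zero_mem _, by simp⟩
    | succ k ih =>
      obtain ⟨r, hr, hxr⟩ := ih
      obtain ⟨s, hs, hxs⟩ := exists_pow_sub_self_eq hf (pow_mem hx ((p ^ f) ^ k))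
      refine ⟨r - s, sub_mem hr hs, ?_⟩
      rw [← pow_mul, ← pow_succ] at hxs
      simp only at hxr ⊢
      linear_combination hxr + hxs
  have hlim : Filter.Tendsto (fun k : ℕ => x - x ^ (p ^ f) ^ k) Filter.atTop (nhds (x - 0)) := by
    refine tendsto_const_nhds.sub ?_
    exact (tendsto_pow_atTop_nhds_zero_of_norm_lt_one h).comp
      (tendsto_pow_atTop_atTop_of_one_lt (by omega))
  rw [sub_zero] at hlim
  obtain ⟨r, hr, hxr⟩ := hcl.mem_of_tendsto hlim (Filter.Eventually.of_forall hk)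
  exact ⟨r, hr, hxr.symm⟩

theorem isIntegral_of_pow_eq_one (hf : 0 < f) {ζ : ℂ_[p]} (h : ζ ^ (p ^ f - 1) = 1) :
    IsIntegral ℚ_[p] ζ := by
  have := two_le_prime_pow (p := p) hf
  exact IsIntegral.of_pow (show 0 < p ^ f - 1 by omega) (h ▸ isIntegral_one)

theorem exists_pow_mul_mem_rootsOrder (hf : 0 < f) {x : ℂ_[p]} (hx : x ∈ Qq p f) :
    ∃ m : ℕ, (p : ℂ_[p]) ^ m * x ∈ rootsOrder p f := by
  have hp : ∀ m : ℕ, (p : ℂ_[p]) ^ m ∈ rootsOrder p f := fun m => pow_mem (natCast_mem _ p) m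
  have hx' : x ∈ Algebra.adjoin ℚ_[p] {ζ : ℂ_[p] | ζ ^ (p ^ f - 1) = 1} := by
    rw [← IntermediateField.adjoin_toSubalgebra_of_isAlgebraic]
    · exact hx
    · intro ζ hζ
      exact (isIntegral_of_pow_eq_one hf hζ).isAlgebraic
  clear hx
  induction hx' using Algebra.adjoin_induction with
  | mem x hx => exact ⟨0, by rw [pow_zero, one_mul]; exact Algebra.subset_adjoin hx⟩
  | algebraMap c =>
    obtain ⟨m, hm⟩ := pow_unbounded_of_one_lt ‖c‖ (one_lt_prime_real (p := p))
    have h1 : ‖(p : ℚ_[p]) ^ m * c‖ ≤ 1 := by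
      rw [norm_mul, norm_pow, Padic.norm_p, inv_pow, inv_mul_le_iff₀ (by
        have := one_lt_prime_real (p := p); positivity), mul_one]
      exact hm.le
    refine ⟨m, ?_⟩
    have h2 : (p : ℂ_[p]) ^ m * algebraMap ℚ_[p] ℂ_[p] c =
        algebraMap ℤ_[p] ℂ_[p] (⟨(p : ℚ_[p]) ^ m * c, h1⟩ : ℤ_[p]) := by
      refine Eq.trans ?_ (algebraMap_padicInt_apply _).symm
      rw [map_mul, map_pow, map_natCast]
    rw [h2]
    exact Subalgebra.algebraMap_mem _ _
  | add x y _ _ hx hy =>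
    obtain ⟨m, hm⟩ := hx
    obtain ⟨n, hn⟩ := hy
    refine ⟨m + n, ?_⟩
    have := add_mem (mul_mem (hp n) hm) (mul_mem (hp m) hn)
    convert this using 1
    ring
  | mul x y _ _ hx hy =>
    obtain ⟨m, hm⟩ := hx
    obtain ⟨n, hn⟩ := hy
    refine ⟨m + n, ?_⟩
    have := mul_mem hm hn
    convert this using 1
    ring

/-- `ℤ_q = ℤ_p[μ_{q-1}]`: the extension `ℚ_q` is unramified. -/
theorem mem_rootsOrder (hf : 0 < f) {x : ℂ_[p]} (hx : x ∈ Qq p f) (h : ‖x‖ ≤ 1) :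
    x ∈ rootsOrder p f := by
  obtain ⟨m, hm⟩ := exists_pow_mul_mem_rootsOrder hf hx
  induction m with
  | zero => simpa using hm
  | succ m ih =>
    have h1 : ‖(p : ℂ_[p]) ^ (m + 1) * x‖ < 1 := by
      rw [norm_mul, norm_pow, norm_natCast_prime]
      refine mul_lt_one_of_nonneg_of_lt_one_left (by positivity) ?_ h
      exact pow_lt_one₀ (by positivity) prime_inv_lt_one (by omega)
    obtain ⟨r, hr, hxr⟩ := exists_eq_mul_of_norm_lt_one hf hm h1
    refine ih ?_
    rw [pow_succ', mul_assoc] at hxr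
    rwa [mul_left_cancel₀ natCast_prime_ne_zero hxr]

theorem norm_pow_sub_self_le (hf : 0 < f) {x : ℂ_[p]} (hx : x ∈ Qq p f) (h : ‖x‖ ≤ 1) :
    ‖x ^ p ^ f - x‖ ≤ (p : ℝ)⁻¹ := by
  obtain ⟨r, hr, hxr⟩ := exists_pow_sub_self_eq hf (mem_rootsOrder hf hx h)
  rw [hxr, norm_mul, norm_natCast_prime]
  exact mul_le_of_le_one_right (by positivity) (rootsOrder_norm_le hf hr)

/-- The norm of `ℚ_q` takes no value strictly between `p⁻¹` and `1`. -/
theorem norm_le_inv_of_norm_lt_one (hf : 0 < f) {x : ℂ_[p]} (hx : x ∈ Qq p f) (h : ‖x‖ < 1) :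
    ‖x‖ ≤ (p : ℝ)⁻¹ := by
  obtain ⟨r, hr, hxr⟩ := exists_eq_mul_of_norm_lt_one hf (mem_rootsOrder hf hx h.le) h
  rw [hxr, norm_mul, norm_natCast_prime]
  exact mul_le_of_le_one_right (by positivity) (rootsOrder_norm_le hf hr)

theorem finiteDimensional_Qq (hf : 0 < f) : FiniteDimensional ℚ_[p] (Qq p f) := by
  have : Finite {ζ : ℂ_[p] | ζ ^ (p ^ f - 1) = 1} := (finite_roots hf).to_subtype
  exact IntermediateField.finiteDimensional_adjoin fun ζ hζ => isIntegral_of_pow_eq_one hf hζ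

theorem isComplete_Qq (hf : 0 < f) : IsComplete (Qq p f : Set ℂ_[p]) := by
  have := finiteDimensional_Qq (p := p) hf
  have : FiniteDimensional ℚ_[p] (Subalgebra.toSubmodule (Qq p f).toSubalgebra) := this
  exact Submodule.complete_of_finiteDimensional (Subalgebra.toSubmodule (Qq p f).toSubalgebra)

theorem isClosed_Qq (hf : 0 < f) : IsClosed (Qq p f : Set ℂ_[p]) := (isComplete_Qq hf).isClosed

theorem isGalois_Qq (hf : 0 < f) : IsGalois ℚ_[p] (Qq p f) := by
  have h2 := two_le_prime_pow (p := p) hf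
  have hS : {ζ : ℂ_[p] | ζ ^ (p ^ f - 1) = 1} =
      (Polynomial.X ^ (p ^ f - 1) - 1 : ℚ_[p][X]).rootSet ℂ_[p] := by
    ext ζ
    rw [Polynomial.mem_rootSet]
    have : (Polynomial.X ^ (p ^ f - 1) - 1 : ℚ_[p][X]) ≠ 0 :=
      (Polynomial.monic_X_pow_sub_C 1 (by omega)).ne_zero
    simp [this, sub_eq_zero]
  have h3 : (Polynomial.X ^ (p ^ f - 1) - 1 : ℚ_[p][X]).IsSplittingField ℚ_[p] (Qq p f) := by
    rw [Qq, hS]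
    exact IntermediateField.adjoin_rootSet_isSplittingField (IsAlgClosed.splits _)
  refine IsGalois.of_separable_splitting_field (p := (Polynomial.X ^ (p ^ f - 1) - 1 : ℚ_[p][X])) ?_
  exact (Polynomial.separable_X_pow_sub_C (1 : ℚ_[p])
    (Nat.cast_ne_zero.mpr (by omega)) one_ne_zero)

/-- For every `n` there are `q ^ n * (q - 1)` units of `ℤ_q` at pairwise distances at least `p⁻ⁿ`,
namely the sums `∑_{i ≤ n} tᵢ pⁱ` with `tᵢ ^ q = tᵢ` and `t₀ ≠ 0`. -/
theorem exists_separated_units (hf : 0 < f) (n : ℕ) : ∃ S : Finset ℂ_[p],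
    S.card = (p ^ f) ^ n * (p ^ f - 1) ∧ (∀ a ∈ S, a ∈ Qq p f ∧ ‖a‖ = 1) ∧
      ∀ a ∈ S, ∀ b ∈ S, a ≠ b → ((p : ℝ) ^ n)⁻¹ ≤ ‖a - b‖ := by
  classical
  have h2 := two_le_prime_pow (p := p) hf
  have : NeZero (p ^ f - 1) := ⟨by omega⟩
  have : NeZero ((p ^ f - 1 : ℕ) : ℂ_[p]) := ⟨Nat.cast_ne_zero.mpr (by omega)⟩
  obtain ⟨ζ, hζ⟩ := HasEnoughRootsOfUnity.exists_primitiveRoot ℂ_[p] (p ^ f - 1)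
  have hroot : ∀ t ∈ Polynomial.nthRootsFinset (p ^ f - 1) (1 : ℂ_[p]), t ^ (p ^ f - 1) = 1 :=
    fun t ht => (Polynomial.mem_nthRootsFinset (by omega) _).mp ht
  have hmem : ∀ t ∈ Polynomial.nthRootsFinset (p ^ f - 1) (1 : ℂ_[p]), t ∈ Qq p f :=
    fun t ht => IntermediateField.subset_adjoin _ _ (hroot t ht)
  have hsep : ∀ t u : ℂ_[p], t ^ p ^ f = t → u ^ p ^ f = u → ‖t‖ ≤ 1 → ‖u‖ ≤ 1 → t ≠ u →
      1 ≤ ‖t - u‖ := by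
    intro t u ht hu htn hun htu
    by_contra! hlt
    -- The `q`-power map fixes `t` and `u`, yet it would strictly contract their distance.
    have h1 := norm_pow_sub_pow_le htn hun (dvd_pow_self p hf.ne')
    rw [ht, hu] at h1
    have h3 : 0 < ‖t - u‖ := norm_pos_iff.mpr (sub_ne_zero.mpr htu)
    have h4 : max (p : ℝ)⁻¹ ‖t - u‖ < 1 := max_lt prime_inv_lt_one hlt
    nlinarith
  have hpow : ∀ t ∈ Polynomial.nthRootsFinset (p ^ f - 1) (1 : ℂ_[p]), t ^ p ^ f = t := by
    intro t ht
    rw [show p ^ f = p ^ f - 1 + 1 by omega, pow_succ, hroot t ht, one_mul]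
  have hnorm : ∀ t ∈ Polynomial.nthRootsFinset (p ^ f - 1) (1 : ℂ_[p]), ‖t‖ = 1 :=
    fun t ht => norm_eq_one_of_pow_eq_one hf (hroot t ht)
  induction n with
  | zero =>
    refine ⟨Polynomial.nthRootsFinset (p ^ f - 1) (1 : ℂ_[p]), by simp [hζ.card_nthRootsFinset],
      fun a ha => ⟨hmem a ha, hnorm a ha⟩, fun a ha b hb hab => ?_⟩
    simpa using hsep a b (hpow a ha) (hpow b hb) (hnorm a ha).le (hnorm b hb).le hab
  | succ n ih =>
    obtain ⟨S, hS, hSu, hSs⟩ := ih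
    set T : Finset ℂ_[p] := insert 0 (Polynomial.nthRootsFinset (p ^ f - 1) (1 : ℂ_[p])) with hT
    have h0 : (0 : ℂ_[p]) ∉ Polynomial.nthRootsFinset (p ^ f - 1) (1 : ℂ_[p]) := fun h => by
      simpa using hnorm 0 h
    have hTcard : T.card = p ^ f := by
      rw [hT, Finset.card_insert_of_notMem h0, hζ.card_nthRootsFinset]
      omega
    have hTmem : ∀ t ∈ T, t ∈ Qq p f ∧ t ^ p ^ f = t ∧ ‖t‖ ≤ 1 := by
      intro t ht
      rcases Finset.mem_insert.mp ht with rfl | ht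
      · exact ⟨zero_mem _, by simp [show p ≠ 0 from (Fact.out : p.Prime).ne_zero], by simp⟩
      · exact ⟨hmem t ht, hpow t ht, (hnorm t ht).le⟩
    have hpn : 0 < (p : ℝ) := by have := one_lt_prime_real (p := p); positivity
    have hlt : ((p : ℝ) ^ (n + 1))⁻¹ < ((p : ℝ) ^ n)⁻¹ := by
      gcongr
      · exact one_lt_prime_real
      · omega
    have hnp : ∀ m : ℕ, ‖(p : ℂ_[p]) ^ m‖ = ((p : ℝ) ^ m)⁻¹ := fun m => by
      rw [norm_pow, norm_natCast_prime, inv_pow]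
    have hstep : ∀ a ∈ S, ∀ t ∈ T, ∀ b ∈ S, ∀ u ∈ T, (a, t) ≠ (b, u) →
        ((p : ℝ) ^ (n + 1))⁻¹ ≤ ‖(a + p ^ (n + 1) * t) - (b + p ^ (n + 1) * u)‖ := by
      intro a ha t ht b hb u hu hne
      by_cases hab : a = b
      · subst hab
        have htu : t ≠ u := fun h => hne (by rw [h])
        rw [add_sub_add_left_eq_sub, ← mul_sub, norm_mul, hnp]
        exact le_mul_of_one_le_right (by positivity)
          (hsep t u (hTmem t ht).2.1 (hTmem u hu).2.1 (hTmem t ht).2.2 (hTmem u hu).2.2 htu)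
      · have h1 := hSs a ha b hb hab
        have h3 : ‖(p : ℂ_[p]) ^ (n + 1) * (t - u)‖ ≤ ((p : ℝ) ^ (n + 1))⁻¹ := by
          rw [norm_mul, hnp]
          refine mul_le_of_le_one_right (by positivity) ?_
          exact (norm_sub_le_max' _ _).trans
            (max_le (hTmem t ht).2.2 (hTmem u hu).2.2)
        have h4 : ‖a - b‖ ≤ max ‖(a + p ^ (n + 1) * t) - (b + p ^ (n + 1) * u)‖
            ‖(p : ℂ_[p]) ^ (n + 1) * (t - u)‖ := by
          refine le_trans (le_of_eq ?_) (norm_sub_le_max' _ _)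
          congr 1
          ring
        rcases le_max_iff.mp h4 with h | h
        · exact hlt.le.trans (h1.trans h)
        · linarith
    have hinj : Set.InjOn (fun x : ℂ_[p] × ℂ_[p] => x.1 + p ^ (n + 1) * x.2) (S ×ˢ T : Finset _) := by
      rintro ⟨a, t⟩ hat ⟨b, u⟩ hbu hxy
      simp only [Finset.coe_product, Set.mem_prod, Finset.mem_coe] at hat hbu hxy
      by_contra hne
      have := hstep a hat.1 t hat.2 b hbu.1 u hbu.2 hne
      rw [hxy, sub_self, norm_zero] at this
      have : 0 < ((p : ℝ) ^ (n + 1))⁻¹ := by positivity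
      linarith
    refine ⟨(S ×ˢ T).image fun x => x.1 + p ^ (n + 1) * x.2, ?_, ?_, ?_⟩
    · rw [Finset.card_image_of_injOn hinj, Finset.card_product, hS, hTcard]
      ring
    · intro a ha
      obtain ⟨⟨a, t⟩, hat, rfl⟩ := Finset.mem_image.mp ha
      obtain ⟨ha, ht⟩ := Finset.mem_product.mp hat
      refine ⟨add_mem (hSu a ha).1 (mul_mem (pow_mem (natCast_mem _ p) _) (hTmem t ht).1), ?_⟩
      have h1 : ‖(p : ℂ_[p]) ^ (n + 1) * t‖ < ‖a‖ := by
        rw [(hSu a ha).2, norm_mul, hnp]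
        refine mul_lt_one_of_nonneg_of_lt_one_left (by positivity) ?_ (hTmem t ht).2.2
        exact inv_lt_one_of_one_lt₀ (one_lt_pow₀ one_lt_prime_real (by omega))
      rw [IsUltrametricDist.norm_add_eq_max_of_norm_ne_norm h1.ne', max_eq_left h1.le,
        (hSu a ha).2]
    · intro x hx y hy hxy
      obtain ⟨⟨a, t⟩, hat, rfl⟩ := Finset.mem_image.mp hx
      obtain ⟨⟨b, u⟩, hbu, rfl⟩ := Finset.mem_image.mp hy
      obtain ⟨ha, ht⟩ := Finset.mem_product.mp hat
      obtain ⟨hb, hu⟩ := Finset.mem_product.mp hbu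
      exact hstep a ha t ht b hb u hu fun h => hxy (by rw [h])

end Unramified

/-! ### Growth and functional equation of `Ψ_q` -/

section Psi

variable {p : ℕ} [Fact p.Prime] {f : ℕ}

theorem coeff_psiCp (k : ℕ) : PowerSeries.coeff k (psiCp p f) =
    ((PowerSeries.coeff k (psi p (p ^ f)) : ℤ) : ℂ_[p]) := by
  simp [psiCp]

theorem coeff_zero_psiCp (hf : 0 < f) : PowerSeries.coeff 0 (psiCp p f) = 0 := by
  rw [coeff_psiCp, (isPsi_psi (Fact.out : p.Prime).ne_zero (two_le_prime_pow hf)).1, Int.cast_zero]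

theorem coeff_one_psiCp (hf : 0 < f) : PowerSeries.coeff 1 (psiCp p f) = 1 := by
  rw [coeff_psiCp, (isPsi_psi (Fact.out : p.Prime).ne_zero (two_le_prime_pow hf)).2.1, Int.cast_one]

theorem coeff_psiCp_pow_eq_zero (hf : 0 < f) {k N : ℕ} (h : k < N) :
    PowerSeries.coeff k (psiCp p f ^ N) = 0 := by
  have hX : (PowerSeries.X : ℂ_[p]⟦X⟧) ∣ psiCp p f := by
    rw [PowerSeries.X_dvd_iff, ← PowerSeries.coeff_zero_eq_constantCoeff_apply]
    exact coeff_zero_psiCp hf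
  exact PowerSeries.X_pow_dvd_iff.mp (pow_dvd_pow_of_dvd hX N) k h

/-- The term of degree `k` of `p⁻ʲ Ψ_q(pʲ x) ^ qʲ`. -/
noncomputable def psiTerm (p : ℕ) [Fact p.Prime] (f j k : ℕ) (x : ℂ_[p]) : ℂ_[p] :=
  ((p : ℂ_[p]) ^ j)⁻¹ * (PowerSeries.coeff k (psiCp p f ^ (p ^ f) ^ j) * (p ^ j * x) ^ k)

/-- The functional equation in degree `k`, multiplied by `xᵏ`; the terms with `j > k` vanish, so that
any number `K ≥ k` of terms may be taken. -/
theorem coeff_psiCp_mul_pow (hf : 0 < f) {k K : ℕ} (hK : k ≤ K) (x : ℂ_[p]) :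
    PowerSeries.coeff k (psiCp p f) * x ^ k = PowerSeries.coeff k (PowerSeries.X : ℂ_[p]⟦X⟧) * x ^ k -
      ∑ j ∈ Finset.range K, psiTerm p f (j + 1) k x := by
  have h2 := two_le_prime_pow (p := p) hf
  have h1 : PowerSeries.coeff k (psiCp p f) = PowerSeries.coeff k (PowerSeries.X : ℂ_[p]⟦X⟧) -
      ∑ j ∈ Finset.range k, (p : ℂ_[p]) ^ ((j + 1) * (k - 1)) *
        PowerSeries.coeff k (psiCp p f ^ (p ^ f) ^ (j + 1)) := by
    conv_lhs => rw [coeff_psiCp, ← psiStep_psi p h2, psiStep, PowerSeries.coeff_mk]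
    push_cast
    congr 1
    · simp [PowerSeries.coeff_X]
    · rw [Finset.range_eq_Ico, Finset.sum_Ico_add' (fun j => (p : ℂ_[p]) ^ (j * (k - 1)) *
        PowerSeries.coeff k (psiCp p f ^ (p ^ f) ^ j)) 0 k 1]
      refine Finset.sum_congr (by ext; simp) fun j _ => ?_
      rw [psiCp, ← map_pow, PowerSeries.coeff_map]
      simp
  have h3 : ∑ j ∈ Finset.range K, psiTerm p f (j + 1) k x =
      ∑ j ∈ Finset.range k, psiTerm p f (j + 1) k x := by
    refine (Finset.sum_subset (Finset.range_subset_range.mpr hK) fun j _ hj => ?_).symm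
    have hkj : k < j + 1 := by have := Finset.mem_range.not.mp hj; omega
    rw [psiTerm, coeff_psiCp_pow_eq_zero hf (hkj.trans (Nat.lt_pow_self (by omega)))]
    simp
  rw [h3, h1, sub_mul, Finset.sum_mul]
  congr 1
  refine Finset.sum_congr rfl fun j hj => ?_
  obtain ⟨l, rfl⟩ : ∃ l, k = l + 1 := ⟨k - 1, by have := Finset.mem_range.mp hj; omega⟩
  have hp : (p : ℂ_[p]) ^ (j + 1) ≠ 0 := pow_ne_zero _ natCast_prime_ne_zero
  rw [psiTerm, mul_pow, pow_succ ((p : ℂ_[p]) ^ (j + 1)) l, Nat.add_sub_cancel, pow_mul]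
  field_simp

theorem norm_psiTerm_le {j k : ℕ} {x : ℂ_[p]} {r B : ℝ} (hr : 0 < r)
    (hB : GaussNormLE (psiCp p f) r B) (hx : ‖x‖ ≤ p ^ j * r) :
    ‖psiTerm p f j k x‖ ≤ p ^ j * B ^ (p ^ f) ^ j := by
  have hp : 0 < (p : ℝ) ^ j := pow_pos (zero_lt_one.trans one_lt_prime_real) j
  rw [psiTerm, norm_mul, norm_inv, norm_pow, norm_natCast_prime, inv_pow, inv_inv]
  refine mul_le_mul_of_nonneg_left ?_ hp.le
  rw [norm_mul, norm_pow, norm_mul, norm_pow, norm_natCast_prime]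
  refine le_trans ?_ ((hB.pow hr _) k)
  gcongr
  rwa [inv_pow, inv_mul_le_iff₀ hp]

theorem norm_intCast_le_one (a : ℤ) : ‖(a : ℂ_[p])‖ ≤ 1 :=
  IsUltrametricDist.norm_intCast_le_one ℂ_[p] a

theorem gaussNormLE_psiCp_of_le_one (hf : 0 < f) {r : ℝ} (hr : 0 ≤ r) (hr1 : r ≤ 1) :
    GaussNormLE (psiCp p f) r r := by
  intro k
  cases k with
  | zero => simpa [coeff_zero_psiCp hf] using hr
  | succ k =>
    rw [coeff_psiCp, pow_succ, ← mul_assoc]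
    exact mul_le_of_le_one_left hr
      (mul_le_one₀ (norm_intCast_le_one _) (by positivity) (pow_le_one₀ hr hr1))

/-- `(q ^ m - 1) / (q - 1) = 1 + q + ⋯ + q ^ (m - 1)`: the Gauss norm of `Ψ_q` on the disc of radius
`p ^ m` is bounded by `p` to this power. -/
def psiGrowth (q m : ℕ) : ℕ := ∑ i ∈ Finset.range m, q ^ i

theorem psiGrowth_add (q j m : ℕ) :
    psiGrowth q (j + m) = psiGrowth q j + psiGrowth q m * q ^ j := by
  rw [psiGrowth, Finset.sum_range_add, psiGrowth, psiGrowth, Finset.sum_mul]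
  simp only [pow_add, mul_comm]

theorem le_psiGrowth {q : ℕ} (hq : 0 < q) (m : ℕ) : m ≤ psiGrowth q m := by
  have : ∑ _i ∈ Finset.range m, 1 ≤ ∑ i ∈ Finset.range m, q ^ i :=
    Finset.sum_le_sum fun i _ => Nat.one_le_pow _ _ hq
  simpa [psiGrowth] using this

/-- For `j > m` and `‖x‖ ≤ p ^ m` the point `pʲ x` lies in the open unit disc, where `Ψ_q` is
controlled by its linear term and the exponent `qʲ` makes the terms tiny. -/
theorem norm_psiTerm_le_inv (hf : 0 < f) {m j k : ℕ} (hj : m < j) {x : ℂ_[p]}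
    (hx : ‖x‖ ≤ p ^ m) : ‖psiTerm p f j k x‖ ≤ ((p : ℝ) ^ j)⁻¹ := by
  have hp := one_lt_prime_real (p := p)
  have hp0 : (0 : ℝ) < p := zero_lt_one.trans hp
  obtain ⟨d, rfl⟩ : ∃ d, j = m + d := ⟨j - m, by omega⟩
  have hd : 1 ≤ d := by omega
  have hr1 : ((p : ℝ) ^ d)⁻¹ ≤ 1 := inv_le_one_of_one_le₀ (one_le_pow₀ hp.le)
  refine (norm_psiTerm_le (r := ((p : ℝ) ^ d)⁻¹) (by positivity)
    (gaussNormLE_psiCp_of_le_one hf (by positivity) hr1) ?_).trans ?_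
  · rw [pow_add, mul_assoc, mul_inv_cancel₀ (by positivity), mul_one]
    exact hx
  · have h1 : 2 * (m + d) ≤ d * (p ^ f) ^ (m + d) := by
      have h2 : 2 * (m + d) ≤ 2 ^ (m + d) := by
        obtain ⟨e, he⟩ : ∃ e, m + d = e + 1 := ⟨m + d - 1, by omega⟩
        rw [he, pow_succ, mul_comm]
        exact Nat.mul_le_mul_right _ Nat.lt_two_pow_self
      exact (h2.trans (Nat.pow_le_pow_left (two_le_prime_pow hf) _)).trans
        (Nat.le_mul_of_pos_left _ hd)
    rw [inv_pow, ← pow_mul, ← div_eq_mul_inv, div_le_iff₀ (by positivity), ← div_eq_inv_mul,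
      le_div_iff₀ (by positivity), ← pow_add, ← two_mul]
    exact pow_le_pow_right₀ hp.le h1

/-- The functional equation expresses the coefficients of `Ψ_q` through those of the
`Ψ_q(pʲ x) ^ qʲ`, `j ≥ 1`; hence a bound on the disc of radius `p ^ m` follows from those on the
smaller discs. -/
theorem gaussNormLE_psiCp (hf : 0 < f) (m : ℕ) :
    GaussNormLE (psiCp p f) ((p : ℝ) ^ m) ((p : ℝ) ^ psiGrowth (p ^ f) m) := by
  have hp := one_lt_prime_real (p := p)
  have hp0 : (0 : ℝ) < p := zero_lt_one.trans hp
  have hq := two_le_prime_pow (p := p) hf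
  induction m using Nat.strong_induction_on with
  | _ m ih =>
  rcases Nat.eq_zero_or_pos m with rfl | hm
  · simpa [psiGrowth] using gaussNormLE_psiCp_of_le_one (p := p) hf zero_le_one le_rfl
  intro k
  have hx : ‖((p : ℂ_[p]) ^ m)⁻¹‖ = (p : ℝ) ^ m := by
    rw [norm_inv, norm_pow, norm_natCast_prime, inv_pow, inv_inv]
  have h1 : ‖PowerSeries.coeff k (psiCp p f)‖ * ((p : ℝ) ^ m) ^ k =
      ‖PowerSeries.coeff k (psiCp p f) * (((p : ℂ_[p]) ^ m)⁻¹) ^ k‖ := by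
    rw [norm_mul, norm_pow, hx]
  rw [h1, coeff_psiCp_mul_pow hf le_rfl]
  refine (norm_sub_le_max' _ _).trans (max_le ?_ ?_)
  · rw [PowerSeries.coeff_X]
    split_ifs with hk
    · rw [hk, pow_one, one_mul, hx]
      exact pow_le_pow_right₀ hp.le (le_psiGrowth (by omega) m)
    · rw [zero_mul, norm_zero]
      positivity
  · refine IsUltrametricDist.norm_sum_le_of_forall_le_of_nonneg (by positivity) fun j _ => ?_
    rcases Nat.lt_or_ge m (j + 1) with hj | hj
    · refine (norm_psiTerm_le_inv hf hj hx.le).trans ?_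
      exact (inv_le_one_of_one_le₀ (one_le_pow₀ hp.le)).trans (one_le_pow₀ hp.le)
    · obtain ⟨d, rfl⟩ : ∃ d, m = (j + 1) + d := ⟨m - (j + 1), by omega⟩
      refine (norm_psiTerm_le (by positivity) (ih d (by omega)) ?_).trans ?_
      · rw [hx, pow_add]
      · rw [← pow_mul, ← pow_add, psiGrowth_add]
        exact pow_le_pow_right₀ hp.le (Nat.add_le_add_right (le_psiGrowth (by omega) _) _)

theorem isEntire_psiCp (hf : 0 < f) : IsEntire (psiCp p f) := by
  refine IsEntire.of_gaussNormLE fun r => ?_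
  obtain ⟨m, hm⟩ := pow_unbounded_of_one_lt r (one_lt_prime_real (p := p))
  exact ⟨_, _, hm, gaussNormLE_psiCp hf m⟩

/-- The functional equation `∑_j p⁻ʲ Ψ_q(pʲ x) ^ qʲ = x` for the values of `Ψ_q` on `ℂ_p`. -/
theorem tendsto_psi (hf : 0 < f) (x : ℂ_[p]) : Filter.Tendsto
    (fun J : ℕ => x - ∑ j ∈ Finset.range J,
      ((p : ℂ_[p]) ^ (j + 1))⁻¹ * evalCp (psiCp p f) (p ^ (j + 1) * x) ^ (p ^ f) ^ (j + 1))
    Filter.atTop (nhds (evalCp (psiCp p f) x)) := by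
  have hp := one_lt_prime_real (p := p)
  have hp0 : (0 : ℝ) < p := zero_lt_one.trans hp
  obtain ⟨m, hm⟩ := pow_unbounded_of_one_lt ‖x‖ hp
  have hent := isEntire_psiCp (p := p) hf
  have hsum : ∀ j : ℕ, HasSum (fun k => psiTerm p f j k x)
      (((p : ℂ_[p]) ^ j)⁻¹ * evalCp (psiCp p f) (p ^ j * x) ^ (p ^ f) ^ j) := fun j => by
    rw [← hent.evalCp_pow]
    exact (((hent.pow _) _).hasSum).mul_left _
  have hX : HasSum (fun k => PowerSeries.coeff k (PowerSeries.X : ℂ_[p]⟦X⟧) * x ^ k) x := by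
    have h1 := IsEntire.coe (Polynomial.X : ℂ_[p][X]) x
    have h2 := h1.hasSum
    rw [← evalCp, evalCp_coe] at h2
    simpa using h2
  refine tendsto_iff_norm_sub_tendsto_zero.mpr ?_
  refine squeeze_zero' (Filter.Eventually.of_forall fun J => norm_nonneg _) (g := fun J : ℕ =>
    ((p : ℝ)⁻¹) ^ J) ?_ (tendsto_pow_atTop_nhds_zero_of_lt_one (by positivity) prime_inv_lt_one)
  filter_upwards [Filter.eventually_ge_atTop m] with J hJ
  -- In degree `k` only the terms with index `J ≤ j < max J k` of the functional equation remain.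
  have h1 := ((hX.sub (hasSum_sum fun j (_ : j ∈ Finset.range J) => hsum (j + 1))).sub (hent x).hasSum)
  rw [← evalCp] at h1
  rw [← h1.tsum_eq]
  refine IsUltrametricDist.norm_tsum_le_of_forall_le fun k => ?_
  rw [coeff_psiCp_mul_pow hf (le_max_right J k), sub_sub_sub_cancel_left,
    ← Finset.sum_Ico_eq_sub _ (le_max_left J k)]
  refine IsUltrametricDist.norm_sum_le_of_forall_le_of_nonneg (by positivity) fun j hj => ?_
  have hJj := (Finset.mem_Ico.mp hj).1
  refine (norm_psiTerm_le_inv hf (by omega) hm.le).trans ?_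
  rw [inv_pow]
  gcongr
  · exact hp.le
  · omega

theorem evalCp_psiCp_mem_Qq (hf : 0 < f) {x : ℂ_[p]} (hx : x ∈ Qq p f) :
    evalCp (psiCp p f) x ∈ Qq p f := by
  refine (isClosed_Qq hf).mem_of_tendsto (isEntire_psiCp hf x).hasSum.tendsto_sum_nat
    (Filter.Eventually.of_forall fun n => ?_)
  refine sum_mem fun k _ => mul_mem ?_ (pow_mem hx k)
  rw [coeff_psiCp]
  exact intCast_mem _ _

/-! ### `Ψ_q` near `ℚ_q`: integrality and local isometry -/

theorem norm_pow_sub_pow_le_radius {R : ℝ} {u v : ℂ_[p]} (hu : ‖u‖ ≤ R) (hv : ‖v‖ ≤ R)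
    (k : ℕ) : ‖u ^ (k + 1) - v ^ (k + 1)‖ ≤ R ^ k * ‖u - v‖ := by
  have hR : 0 ≤ R := (norm_nonneg u).trans hu
  rw [← (Commute.all u v).geom_sum₂_mul, norm_mul]
  refine mul_le_mul_of_nonneg_right ?_ (norm_nonneg _)
  refine IsUltrametricDist.norm_sum_le_of_forall_le_of_nonneg (by positivity) fun j hj => ?_
  have hj' : j + (k + 1 - 1 - j) = k := by have := Finset.mem_range.mp hj; omega
  rw [norm_mul, norm_pow, norm_pow]
  calc _ ≤ R ^ j * R ^ (k + 1 - 1 - j) := by gcongr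
    _ = R ^ k := by rw [← pow_add, hj']

theorem norm_pow_pow_sub_pow_le (hf : 0 < f) {u : ℂ_[p]} (hu : u ∈ Qq p f) (hu1 : ‖u‖ ≤ 1)
    (j : ℕ) : ‖u ^ (p ^ f) ^ j - u ^ (p ^ f) ^ (j + 1)‖ ≤ ((p : ℝ) ^ (j + 1))⁻¹ := by
  induction j with
  | zero =>
    rw [norm_sub_rev]
    simpa using norm_pow_sub_self_le hf hu hu1
  | succ j ih =>
    have h1 := norm_pow_sub_pow_le (U := u ^ (p ^ f) ^ j) (V := u ^ (p ^ f) ^ (j + 1))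
      (by rw [norm_pow]; exact pow_le_one₀ (norm_nonneg _) hu1)
      (by rw [norm_pow]; exact pow_le_one₀ (norm_nonneg _) hu1) (dvd_pow_self p hf.ne')
    rw [← pow_mul u, ← pow_mul u, ← pow_succ, ← pow_succ] at h1
    refine h1.trans ?_
    have hp := one_lt_prime_real (p := p)
    have h2 : ((p : ℝ) ^ (j + 1))⁻¹ ≤ (p : ℝ)⁻¹ := by
      gcongr
      exact le_self_pow₀ hp.le (by omega)
    rw [max_eq_left (ih.trans h2), pow_succ _ (j + 1), mul_inv, mul_comm]
    gcongr

/-- `Ψ_q` is integral at `x ∈ ℚ_q` if it is so at all `pʲ x`, `j ≥ 1`: the functional equation at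
`x` and at `p x` give `Ψ_q(x) = ∑_{j ≥ 1} p⁻ʲ (uⱼ ^ q ^ (j - 1) - uⱼ ^ q ^ j)`, `uⱼ = Ψ_q(pʲ x)`. -/
theorem norm_evalCp_psiCp_le_one_of_forall (hf : 0 < f) {x : ℂ_[p]} (hx : x ∈ Qq p f)
    (h : ∀ j : ℕ, ‖evalCp (psiCp p f) (p ^ (j + 1) * x)‖ ≤ 1) : ‖evalCp (psiCp p f) x‖ ≤ 1 := by
  have hp0 := natCast_prime_ne_zero (p := p)
  have hpos : (0 : ℝ) < p := zero_lt_one.trans one_lt_prime_real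
  set u : ℕ → ℂ_[p] := fun j => evalCp (psiCp p f) (p ^ (j + 1) * x) with hu
  have h1 := (Filter.tendsto_add_atTop_iff_nat 1).mpr (tendsto_psi hf x)
  have h2 := tendsto_psi hf ((p : ℂ_[p]) * x)
  have h3 := h1.add ((tendsto_const_nhds (x := u 0)).sub h2 |>.const_mul (p : ℂ_[p])⁻¹)
  have hu0 : u 0 = evalCp (psiCp p f) (p * x) := by simp [hu]
  rw [hu0, sub_self, mul_zero, add_zero] at h3
  refine le_of_tendsto h3.norm (Filter.Eventually.of_forall fun J => ?_)
  have h4 : (x - ∑ j ∈ Finset.range (J + 1), ((p : ℂ_[p]) ^ (j + 1))⁻¹ * u j ^ (p ^ f) ^ (j + 1)) +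
      (p : ℂ_[p])⁻¹ * (u 0 - (p * x - ∑ j ∈ Finset.range J,
        ((p : ℂ_[p]) ^ (j + 1))⁻¹ * u (j + 1) ^ (p ^ f) ^ (j + 1))) =
      ∑ j ∈ Finset.range (J + 1), ((p : ℂ_[p]) ^ (j + 1))⁻¹ *
        (u j ^ (p ^ f) ^ j - u j ^ (p ^ f) ^ (j + 1)) := by
    simp only [mul_sub, Finset.sum_sub_distrib]
    rw [Finset.sum_range_succ' (fun j => ((p : ℂ_[p]) ^ (j + 1))⁻¹ * u j ^ (p ^ f) ^ j),
      Finset.mul_sum]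
    have h5 : ∑ j ∈ Finset.range J, (p : ℂ_[p])⁻¹ *
        (((p : ℂ_[p]) ^ (j + 1))⁻¹ * u (j + 1) ^ (p ^ f) ^ (j + 1)) =
        ∑ j ∈ Finset.range J, ((p : ℂ_[p]) ^ (j + 1 + 1))⁻¹ * u (j + 1) ^ (p ^ f) ^ (j + 1) := by
      refine Finset.sum_congr rfl fun j _ => ?_
      rw [pow_succ _ (j + 1), mul_inv]
      ring
    rw [h5]
    have h6 : (p : ℂ_[p])⁻¹ * (p * x) = x := by field_simp
    rw [h6]
    simp only [zero_add, pow_one, pow_zero]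
    ring
  have h7 : ∀ j : ℕ, evalCp (psiCp p f) (p ^ (j + 1) * (p * x)) = u (j + 1) := fun j => by
    simp only [hu]
    rw [pow_succ _ (j + 1), mul_assoc]
  simp only [h7, ← hu0]
  rw [h4]
  refine IsUltrametricDist.norm_sum_le_of_forall_le_of_nonneg zero_le_one fun j _ => ?_
  rw [norm_mul, norm_inv, norm_pow, norm_natCast_prime, inv_pow, inv_inv]
  have hmem : u j ∈ Qq p f :=
    evalCp_psiCp_mem_Qq hf (mul_mem (pow_mem (natCast_mem _ p) _) hx)
  calc _ ≤ (p : ℝ) ^ (j + 1) * ((p : ℝ) ^ (j + 1))⁻¹ := by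
        gcongr
        exact norm_pow_pow_sub_pow_le hf hmem (h j) j
    _ = 1 := mul_inv_cancel₀ (by positivity)

/-- The linear term dominates the difference of two values of `Ψ_q` on a disc of radius less than `p`
around the origin. -/
theorem norm_psi_sub_psi_sub_le_of_norm_le (hf : 0 < f) {R : ℝ} (hRp : R < p) {u v : ℂ_[p]}
    (hu : ‖u‖ ≤ R) (hv : ‖v‖ ≤ R) :
    ‖evalCp (psiCp p f) u - evalCp (psiCp p f) v - (u - v)‖ ≤ R / p * ‖u - v‖ := by
  have hpos : (0 : ℝ) < p := zero_lt_one.trans one_lt_prime_real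
  have hR : 0 ≤ R := (norm_nonneg u).trans hu
  have hent := isEntire_psiCp (p := p) hf
  have hdelta : HasSum (fun k : ℕ => if k = 1 then u - v else 0) (u - v) := hasSum_ite_eq 1 _
  have h1 := ((hent u).hasSum.sub (hent v).hasSum).sub hdelta
  rw [← evalCp, ← evalCp] at h1
  rw [← h1.tsum_eq]
  refine IsUltrametricDist.norm_tsum_le_of_forall_le fun k => ?_
  match k with
  | 0 => simp; positivity
  | 1 => simp [coeff_one_psiCp hf]; positivity
  | k + 2 =>
    -- `p ^ (k - 1)` divides the coefficient of `T ^ k`: the Gauss norm on the disc of radius `p` is `p`.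
    have hcoeff : ‖PowerSeries.coeff (k + 2) (psiCp p f)‖ ≤ ((p : ℝ) ^ (k + 1))⁻¹ := by
      have h2 := gaussNormLE_psiCp (p := p) hf 1 (k + 2)
      rw [show psiGrowth (p ^ f) 1 = 1 by simp [psiGrowth], pow_one, pow_succ, ← mul_assoc] at h2
      rw [← one_div, le_div_iff₀ (by positivity)]
      exact le_of_mul_le_mul_right (by simpa using h2) hpos
    rw [if_neg (by omega), sub_zero, ← mul_sub, norm_mul]
    calc _ ≤ ((p : ℝ) ^ (k + 1))⁻¹ * (R ^ (k + 1) * ‖u - v‖) := by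
          gcongr
          exact norm_pow_sub_pow_le_radius hu hv (k + 1)
      _ = (R / p) ^ k * (R / p * ‖u - v‖) := by
          rw [div_pow]
          field_simp
          ring
      _ ≤ R / p * ‖u - v‖ :=
          mul_le_of_le_one_left (by positivity) (pow_le_one₀ (by positivity)
            ((div_le_one hpos).mpr hRp.le))

/-- `Ψ_q` maps `ℚ_q` to `ℤ_q`, and `Ψ_q(u) - Ψ_q(v) = (u - v)(1 + o(1))` on each open disc of
radius `p` around a point of `ℚ_q`. Both are proved together, the functional equation reducing
them for `x` to the points `pʲ x`, `j ≥ 1`. -/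
theorem psi_near_Qq_aux (hf : 0 < f) (n : ℕ) : ∀ x ∈ Qq p f, ‖x‖ ≤ p ^ n →
    ‖evalCp (psiCp p f) x‖ ≤ 1 ∧ ∀ R : ℝ, 1 ≤ R → R < p → ∀ u v : ℂ_[p], ‖u - x‖ ≤ R → ‖v - x‖ ≤ R →
      ‖evalCp (psiCp p f) u - evalCp (psiCp p f) v - (u - v)‖ ≤ R / p * ‖u - v‖ := by
  have hp := one_lt_prime_real (p := p)
  have hpos : (0 : ℝ) < p := zero_lt_one.trans hp
  induction n with
  | zero =>
    intro x _ hx1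
    rw [pow_zero] at hx1
    refine ⟨(gaussNormLE_psiCp_of_le_one hf zero_le_one le_rfl).norm_evalCp_le hx1,
      fun R hR hRp u v hu hv => ?_⟩
    have key : ∀ w : ℂ_[p], ‖w - x‖ ≤ R → ‖w‖ ≤ R := fun w hw => by
      have := IsUltrametricDist.norm_add_le_max (w - x) x
      rw [sub_add_cancel] at this
      exact this.trans (max_le hw (hx1.trans hR))
    exact norm_psi_sub_psi_sub_le_of_norm_le hf hRp (key u hu) (key v hv)
  | succ n ih =>
    intro x hx hxn
    have hmem : ∀ j : ℕ, (p : ℂ_[p]) ^ (j + 1) * x ∈ Qq p f := fun j =>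
      mul_mem (pow_mem (natCast_mem _ p) _) hx
    have hnorm : ∀ j : ℕ, ‖(p : ℂ_[p]) ^ (j + 1)‖ = ((p : ℝ) ^ (j + 1))⁻¹ := fun j => by
      rw [norm_pow, norm_natCast_prime, inv_pow]
    have hinv : ∀ j : ℕ, ((p : ℝ) ^ (j + 1))⁻¹ ≤ (p : ℝ)⁻¹ := fun j => by
      gcongr
      exact le_self_pow₀ hp.le (by omega)
    have hsmall : ∀ j : ℕ, ‖(p : ℂ_[p]) ^ (j + 1) * x‖ ≤ p ^ n := fun j => by
      rw [norm_mul, hnorm]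
      calc _ ≤ (p : ℝ)⁻¹ * p ^ (n + 1) :=
            mul_le_mul (hinv j) hxn (norm_nonneg _) (by positivity)
        _ = p ^ n := by rw [pow_succ]; field_simp
    refine ⟨norm_evalCp_psiCp_le_one_of_forall hf hx fun j =>
      (ih _ (hmem j) (hsmall j)).1, fun R hR hRp u v hu hv => ?_⟩
    have hR1 : R / p ≤ 1 := (div_le_one hpos).mpr hRp.le
    have hshrink : ∀ (j : ℕ) (w : ℂ_[p]), ‖w - x‖ ≤ R →
        ‖(p : ℂ_[p]) ^ (j + 1) * w - p ^ (j + 1) * x‖ ≤ R / p := fun j w hw => by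
      rw [← mul_sub, norm_mul, hnorm, div_eq_inv_mul]
      exact mul_le_mul (hinv j) hw (norm_nonneg _) (by positivity)
    have hiso : ∀ (j : ℕ) (w w' : ℂ_[p]), ‖w - x‖ ≤ R → ‖w' - x‖ ≤ R →
        ‖evalCp (psiCp p f) (p ^ (j + 1) * w) - evalCp (psiCp p f) (p ^ (j + 1) * w')‖ ≤
          ((p : ℝ) ^ (j + 1))⁻¹ * ‖w - w'‖ := fun j w w' hw hw' => by
      have h1 := (ih _ (hmem j) (hsmall j)).2 1 le_rfl hp _ _ ((hshrink j w hw).trans hR1)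
        ((hshrink j w' hw').trans hR1)
      have h2 := IsUltrametricDist.norm_add_le_max
        (evalCp (psiCp p f) (p ^ (j + 1) * w) - evalCp (psiCp p f) (p ^ (j + 1) * w') -
          (p ^ (j + 1) * w - p ^ (j + 1) * w')) (p ^ (j + 1) * w - p ^ (j + 1) * w')
      rw [sub_add_cancel] at h2
      have h3 : ‖(p : ℂ_[p]) ^ (j + 1) * w - p ^ (j + 1) * w'‖ =
          ((p : ℝ) ^ (j + 1))⁻¹ * ‖w - w'‖ := by rw [← mul_sub, norm_mul, hnorm]
      rw [← h3]
      refine h2.trans (max_le (h1.trans ?_) le_rfl)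
      exact mul_le_of_le_one_left (norm_nonneg _) ((div_le_one hpos).mpr hp.le)
    have hint : ∀ (j : ℕ) (w : ℂ_[p]), ‖w - x‖ ≤ R →
        ‖evalCp (psiCp p f) (p ^ (j + 1) * w)‖ ≤ 1 := fun j w hw => by
      have h1 := IsUltrametricDist.norm_add_le_max
        (evalCp (psiCp p f) (p ^ (j + 1) * w) - evalCp (psiCp p f) (p ^ (j + 1) * x))
        (evalCp (psiCp p f) (p ^ (j + 1) * x))
      rw [sub_add_cancel] at h1
      refine h1.trans (max_le ?_ (ih _ (hmem j) (hsmall j)).1)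
      refine (hiso j w x hw (by simpa using zero_le_one.trans hR)).trans ?_
      rw [← hnorm, ← norm_mul, mul_sub]
      exact (hshrink j w hw).trans hR1
    have hlim := ((tendsto_psi hf u).sub (tendsto_psi hf v)).sub_const (u - v)
    refine le_of_tendsto hlim.norm (Filter.Eventually.of_forall fun J => ?_)
    have huv : ‖u - v‖ ≤ R := by
      rw [← sub_sub_sub_cancel_right u v x]
      exact (norm_sub_le_max' _ _).trans (max_le hu hv)
    rw [show ∀ a b : ℂ_[p], u - a - (v - b) - (u - v) = b - a by intros; ring,
      ← Finset.sum_sub_distrib]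
    refine IsUltrametricDist.norm_sum_le_of_forall_le_of_nonneg (by positivity) fun j _ => ?_
    have h1 := norm_pow_sub_pow_le (hint j v hv) (hint j u hu)
      (N := (p ^ f) ^ (j + 1)) ((dvd_pow_self p hf.ne').trans (dvd_pow_self _ (by omega)))
    have h2 := hiso j v u hv hu
    rw [norm_sub_rev v u] at h2
    rw [← mul_sub, norm_mul, norm_inv, hnorm, inv_inv]
    have h3 : max (p : ℝ)⁻¹ ‖evalCp (psiCp p f) (p ^ (j + 1) * v) -
        evalCp (psiCp p f) (p ^ (j + 1) * u)‖ ≤ R / p := by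
      refine max_le ?_ (h2.trans ?_)
      · rw [← one_div]
        gcongr
      · rw [div_eq_inv_mul]
        exact mul_le_mul (hinv j) huv (norm_nonneg _) (by positivity)
    calc _ ≤ (p : ℝ) ^ (j + 1) * (R / p * (((p : ℝ) ^ (j + 1))⁻¹ * ‖u - v‖)) := by
          gcongr
          exact h1.trans (mul_le_mul h3 h2 (norm_nonneg _) (by positivity))
      _ = R / p * ‖u - v‖ := by field_simp

theorem norm_evalCp_psiCp_le_one (hf : 0 < f) {x : ℂ_[p]} (hx : x ∈ Qq p f) :
    ‖evalCp (psiCp p f) x‖ ≤ 1 := by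
  obtain ⟨n, hn⟩ := pow_unbounded_of_one_lt ‖x‖ (one_lt_prime_real (p := p))
  exact (psi_near_Qq_aux hf n x hx hn.le).1

theorem norm_psi_sub_psi_sub_le (hf : 0 < f) {x : ℂ_[p]} (hx : x ∈ Qq p f) {R : ℝ} (hR : 1 ≤ R)
    (hRp : R < p) {u v : ℂ_[p]} (hu : ‖u - x‖ ≤ R) (hv : ‖v - x‖ ≤ R) :
    ‖evalCp (psiCp p f) u - evalCp (psiCp p f) v - (u - v)‖ ≤ R / p * ‖u - v‖ := by
  obtain ⟨n, hn⟩ := pow_unbounded_of_one_lt ‖x‖ (one_lt_prime_real (p := p))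
  exact (psi_near_Qq_aux hf n x hx hn.le).2 R hR hRp u v hu hv

/-- A zero of `Ψ_q` near `x ∈ ℚ_q` is a fixed point of the contraction `y ↦ y - Ψ_q(y)` of
`x + ℤ_q`. -/
theorem exists_zero_near (hf : 0 < f) {x : ℂ_[p]} (hx : x ∈ Qq p f) :
    ∃ z ∈ Qq p f, ‖z - x‖ ≤ 1 ∧ evalCp (psiCp p f) z = 0 := by
  have hp := one_lt_prime_real (p := p)
  have hpos : (0 : ℝ) < p := zero_lt_one.trans hp
  set s : Set ℂ_[p] := (Qq p f : Set ℂ_[p]) ∩ Metric.closedBall x 1 with hs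
  have hcomplete : IsComplete s := ((isClosed_Qq hf).inter Metric.isClosed_closedBall).isComplete
  have hmaps : Set.MapsTo (fun y => y - evalCp (psiCp p f) y) s s := by
    rintro y ⟨hy, hyx⟩
    refine ⟨sub_mem hy (evalCp_psiCp_mem_Qq hf hy), ?_⟩
    rw [mem_closedBall_iff_norm] at hyx ⊢
    rw [sub_right_comm]
    exact (norm_sub_le_max' _ _).trans (max_le hyx (norm_evalCp_psiCp_le_one hf hy))
  have hK : ContractingWith (p : NNReal)⁻¹ (hmaps.restrict _ s s) := by
    refine ⟨?_, LipschitzWith.of_dist_le_mul ?_⟩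
    · have : ((p : NNReal)⁻¹ : ℝ) < 1 := by simpa using prime_inv_lt_one (p := p)
      exact_mod_cast this
    · rintro ⟨u, hu⟩ ⟨v, hv⟩
      have h1 := norm_psi_sub_psi_sub_le hf hx le_rfl hp
        (mem_closedBall_iff_norm.mp hu.2) (mem_closedBall_iff_norm.mp hv.2)
      rw [Subtype.dist_eq, Subtype.dist_eq, dist_eq_norm, dist_eq_norm]
      simp only [Set.MapsTo.val_restrict_apply]
      rw [norm_sub_rev] at h1
      have h2 : u - v - (evalCp (psiCp p f) u - evalCp (psiCp p f) v) =
          u - evalCp (psiCp p f) u - (v - evalCp (psiCp p f) v) := by ring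
      rw [← h2]
      simpa using h1
  obtain ⟨z, hz, hfix, -⟩ := hK.exists_fixedPoint' hcomplete hmaps
    (x := x) ⟨hx, Metric.mem_closedBall_self zero_le_one⟩ (edist_ne_top _ _)
  exact ⟨z, hz.1, mem_closedBall_iff_norm.mp hz.2, by simpa [Function.IsFixedPt] using hfix⟩

theorem eq_of_zeros_near (hf : 0 < f) {x : ℂ_[p]} (hx : x ∈ Qq p f) {u v : ℂ_[p]}
    (hu : ‖u - x‖ < p) (hv : ‖v - x‖ < p) (hu0 : evalCp (psiCp p f) u = 0)
    (hv0 : evalCp (psiCp p f) v = 0) : u = v := by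
  have hp := one_lt_prime_real (p := p)
  have hpos : (0 : ℝ) < p := zero_lt_one.trans hp
  have hR : max 1 (max ‖u - x‖ ‖v - x‖) < p := max_lt hp (max_lt hu hv)
  have h1 := norm_psi_sub_psi_sub_le hf hx (le_max_left _ _) hR
    ((le_max_left _ _).trans (le_max_right _ _)) ((le_max_right _ _).trans (le_max_right _ _))
  rw [hu0, hv0, sub_self, zero_sub, norm_neg] at h1
  by_contra hne
  have h2 : 0 < ‖u - v‖ := norm_pos_iff.mpr (sub_ne_zero.mpr hne)
  have h3 : max 1 (max ‖u - x‖ ‖v - x‖) / p < 1 := (div_lt_one hpos).mpr hR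
  nlinarith

end Psi

/-! ### The zeros of `Ψ_q` -/

section Zeros

variable {p : ℕ} [Fact p.Prime] {f : ℕ}

/-- There are at least `q ^ (n + 1) - q ^ n` zeros of valuation `-(n + 1)`, all of them in `ℚ_q`. -/
theorem exists_finset_zeros (hf : 0 < f) (n : ℕ) : ∃ Z : Finset ℂ_[p],
    Z.card = (p ^ f) ^ n * (p ^ f - 1) ∧
      ∀ z ∈ Z, z ∈ Qq p f ∧ ‖z‖ = (p : ℝ) ^ (n + 1) ∧ evalCp (psiCp p f) z = 0 := by
  classical
  have hp := one_lt_prime_real (p := p)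
  have hpos : (0 : ℝ) < p := zero_lt_one.trans hp
  obtain ⟨S, hS, hSu, hSs⟩ := exists_separated_units (p := p) hf n
  have hdiv : ∀ a : ℂ_[p], ‖a / (p : ℂ_[p]) ^ (n + 1)‖ = ‖a‖ * (p : ℝ) ^ (n + 1) := fun a => by
    rw [norm_div, norm_pow, norm_natCast_prime, inv_pow, div_inv_eq_mul]
  have h1 : ∀ a : ℂ_[p], ∃ z : ℂ_[p], a ∈ S → z ∈ Qq p f ∧ ‖z - a / (p : ℂ_[p]) ^ (n + 1)‖ ≤ 1 ∧
      evalCp (psiCp p f) z = 0 := fun a => by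
    by_cases ha : a ∈ S
    · obtain ⟨z, hz⟩ := exists_zero_near hf
        (div_mem (hSu a ha).1 (pow_mem (natCast_mem _ p) (n + 1)))
      exact ⟨z, fun _ => hz⟩
    · exact ⟨0, fun h => absurd h ha⟩
  choose z hz using h1
  refine ⟨S.image z, ?_, fun y hy => ?_⟩
  · rw [Finset.card_image_of_injOn, hS]
    intro a ha b hb hab
    by_contra hne
    have h2 := hSs a ha b hb hne
    have h3 : ‖(a - b) / (p : ℂ_[p]) ^ (n + 1)‖ ≤ 1 := by
      have h4 : (a - b) / (p : ℂ_[p]) ^ (n + 1) = (z b - b / (p : ℂ_[p]) ^ (n + 1)) -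
          (z a - a / (p : ℂ_[p]) ^ (n + 1)) := by rw [hab]; ring
      rw [h4]
      exact (norm_sub_le_max' _ _).trans (max_le (hz b hb).2.1 (hz a ha).2.1)
    rw [hdiv] at h3
    have h5 : (1 : ℝ) < ((p : ℝ) ^ n)⁻¹ * (p : ℝ) ^ (n + 1) := by
      rw [pow_succ, inv_mul_cancel_left₀ (by positivity)]
      exact hp
    have h6 := mul_le_mul_of_nonneg_right h2 (show 0 ≤ (p : ℝ) ^ (n + 1) by positivity)
    linarith
  · obtain ⟨a, ha, rfl⟩ := Finset.mem_image.mp hy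
    obtain ⟨hzm, hza, hz0⟩ := hz a ha
    refine ⟨hzm, ?_, hz0⟩
    have h2 : ‖a / (p : ℂ_[p]) ^ (n + 1)‖ = (p : ℝ) ^ (n + 1) := by
      rw [hdiv, (hSu a ha).2, one_mul]
    have h3 : ‖z a - a / (p : ℂ_[p]) ^ (n + 1)‖ < ‖a / (p : ℂ_[p]) ^ (n + 1)‖ := by
      rw [h2]
      exact hza.trans_lt (one_lt_pow₀ hp (by omega))
    rw [← h2, ← sub_add_cancel (z a) (a / (p : ℂ_[p]) ^ (n + 1)),
      IsUltrametricDist.norm_add_eq_max_of_norm_ne_norm h3.ne, max_eq_right h3.le]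

/-- A finite set of zeros of `Ψ_q` of valuation `-(n + 1)`, which turns out to be the set of all of
them (`psiZeros_succ`). -/
noncomputable def zeroFinset (p : ℕ) [Fact p.Prime] {f : ℕ} (hf : 0 < f) (n : ℕ) :
    Finset ℂ_[p] := (exists_finset_zeros hf n).choose

theorem card_zeroFinset (hf : 0 < f) (n : ℕ) :
    (zeroFinset p hf n).card = (p ^ f) ^ n * (p ^ f - 1) :=
  (exists_finset_zeros hf n).choose_spec.1

theorem of_mem_zeroFinset (hf : 0 < f) {n : ℕ} {z : ℂ_[p]} (hz : z ∈ zeroFinset p hf n) :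
    z ∈ Qq p f ∧ ‖z‖ = (p : ℝ) ^ (n + 1) ∧ evalCp (psiCp p f) z = 0 :=
  (exists_finset_zeros hf n).choose_spec.2 z hz

theorem ne_zero_of_mem_zeroFinset (hf : 0 < f) {n : ℕ} {z : ℂ_[p]}
    (hz : z ∈ zeroFinset p hf n) : z ≠ 0 := by
  rw [← norm_pos_iff, (of_mem_zeroFinset hf hz).2.1]
  exact pow_pos (zero_lt_one.trans one_lt_prime_real) _

theorem disjoint_zeroFinset (hf : 0 < f) {m n : ℕ} (hmn : m ≠ n) :
    Disjoint (zeroFinset p hf m) (zeroFinset p hf n) := by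
  refine Finset.disjoint_left.mpr fun z hm hn => hmn ?_
  have h1 := (of_mem_zeroFinset hf hm).2.1.symm.trans (of_mem_zeroFinset hf hn).2.1
  have := (pow_right_injective₀ (zero_lt_one.trans one_lt_prime_real)
    (one_lt_prime_real (p := p)).ne') h1
  omega

/-- The polynomial with constant term `1` whose zeros are the points of `zeroFinset p hf n`. -/
noncomputable def zeroFactor (p : ℕ) [Fact p.Prime] {f : ℕ} (hf : 0 < f) (n : ℕ) : ℂ_[p][X] :=
  ∏ z ∈ zeroFinset p hf n, (1 - Polynomial.C z⁻¹ * Polynomial.X)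

/-- With `r = p`: on the disc of radius `p ^ (N + 1)` the bound for the Gauss norm of `Ψ_q` equals the
Gauss norm of the product of `x` and the first `N` factors `zeroFactor`. -/
theorem pow_psiGrowth_mul_prod {q : ℕ} (hq : 0 < q) (r : ℝ) (N : ℕ) :
    r ^ psiGrowth q (N + 1) * ∏ n ∈ Finset.range N, (r ^ (n + 1)) ^ (q ^ n * (q - 1)) =
      (r ^ (N + 1)) ^ q ^ N := by
  induction N with
  | zero => simp [psiGrowth]
  | succ N ih =>
    have h1 : psiGrowth q (N + 1 + 1) = psiGrowth q (N + 1) + q ^ (N + 1) := by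
      rw [psiGrowth, Finset.sum_range_succ, psiGrowth]
    have h2 : q ^ (N + 1) = q ^ N + q ^ N * (q - 1) := by
      obtain ⟨m, rfl⟩ := Nat.exists_eq_add_of_le' hq
      rw [Nat.add_sub_cancel]
      ring
    calc _ = (r ^ psiGrowth q (N + 1) * ∏ n ∈ Finset.range N, (r ^ (n + 1)) ^ (q ^ n * (q - 1))) *
          (r ^ (N + 1)) ^ (q ^ N * (q - 1)) * r ^ q ^ (N + 1) := by
          rw [Finset.prod_range_succ, h1, pow_add]
          ring
      _ = (r ^ (N + 1)) ^ q ^ (N + 1) * r ^ q ^ (N + 1) := by rw [ih, ← pow_add, ← h2]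
      _ = (r ^ (N + 1 + 1)) ^ q ^ (N + 1) := by rw [← mul_pow, ← pow_succ]

/-- `Ψ_q = x ∏_{n < N} zeroFactor n * Q`, with a cofactor `Q` of Gauss norm `1` on the disc of radius
`p ^ (N + 1)`. -/
theorem exists_psi_eq_prod_mul (hf : 0 < f) (N : ℕ) : ∃ Q : ℂ_[p]⟦X⟧,
    psiCp p f = ((Polynomial.X * ∏ n ∈ Finset.range N, zeroFactor p hf n : ℂ_[p][X]) : ℂ_[p]⟦X⟧) * Q ∧
      IsEntire Q ∧ PowerSeries.coeff 0 Q = 1 ∧ GaussNormLE Q ((p : ℝ) ^ (N + 1)) 1 := by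
  classical
  have hp := one_lt_prime_real (p := p)
  have hpos : (0 : ℝ) < p := zero_lt_one.trans hp
  have hq := two_le_prime_pow (p := p) hf
  set F : ℂ_[p]⟦X⟧ := PowerSeries.mk fun k => PowerSeries.coeff (k + 1) (psiCp p f) with hF
  have hXF : psiCp p f = ((Polynomial.X : ℂ_[p][X]) : ℂ_[p]⟦X⟧) * F := by
    ext k
    rw [Polynomial.coe_X]
    cases k with
    | zero => rw [PowerSeries.coeff_zero_X_mul, coeff_zero_psiCp hf]
    | succ k => rw [PowerSeries.coeff_succ_X_mul, hF, PowerSeries.coeff_mk]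
  have hFr : ∀ r M : ℝ, 0 < r → GaussNormLE (psiCp p f) r M → GaussNormLE F r (M / r) := by
    intro r M hr hM k
    rw [hF, PowerSeries.coeff_mk, le_div_iff₀ hr, mul_assoc, ← pow_succ]
    exact hM (k + 1)
  have hFent : IsEntire F := by
    refine IsEntire.of_gaussNormLE fun r => ?_
    obtain ⟨s, M, hs, hs0, hM⟩ := (isEntire_psiCp (p := p) hf).exists_gaussNormLE r
    exact ⟨s, _, hs, hFr s M hs0 hM⟩
  set W : Finset ℂ_[p] := (Finset.range N).biUnion (zeroFinset p hf) with hW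
  have hdisj : ((Finset.range N : Finset ℕ) : Set ℕ).PairwiseDisjoint (zeroFinset p hf) :=
    fun m _ n _ hmn => disjoint_zeroFinset hf hmn
  have hWz : ∀ z ∈ W, z ≠ 0 ∧ evalCp F z = 0 := by
    intro z hz
    obtain ⟨n, -, hzn⟩ := Finset.mem_biUnion.mp hz
    have hz0 := ne_zero_of_mem_zeroFinset hf hzn
    refine ⟨hz0, ?_⟩
    have h1 := (of_mem_zeroFinset hf hzn).2.2
    rw [hXF, (IsEntire.coe _).evalCp_mul hFent, evalCp_coe, Polynomial.eval_X] at h1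
    exact (mul_eq_zero.mp h1).resolve_left hz0
  have hWr : ∀ z ∈ W, ‖z‖ ≤ (p : ℝ) ^ (N + 1) := by
    intro z hz
    obtain ⟨n, hn, hzn⟩ := Finset.mem_biUnion.mp hz
    rw [(of_mem_zeroFinset hf hzn).2.1]
    exact pow_le_pow_right₀ hp.le (by have := Finset.mem_range.mp hn; omega)
  obtain ⟨Q, hFQ, hQ, hb⟩ := hFent.exists_eq_prod_linear_mul W hWz
  have hprod : ∏ z ∈ W, (1 - Polynomial.C z⁻¹ * Polynomial.X : ℂ_[p][X]) =
      ∏ n ∈ Finset.range N, zeroFactor p hf n := by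
    rw [hW, Finset.prod_biUnion hdisj]
    rfl
  have heq : psiCp p f = ((Polynomial.X * ∏ n ∈ Finset.range N, zeroFactor p hf n : ℂ_[p][X]) :
      ℂ_[p]⟦X⟧) * Q := by
    rw [Polynomial.coe_mul, mul_assoc, ← hprod, ← hFQ, ← hXF]
  refine ⟨Q, heq, hQ, ?_, ?_⟩
  · have h1 : PowerSeries.coeff 0 F = 1 := by rw [hF, PowerSeries.coeff_mk, coeff_one_psiCp hf]
    rw [hFQ, PowerSeries.coeff_zero_eq_constantCoeff_apply, map_mul,
      ← PowerSeries.coeff_zero_eq_constantCoeff_apply, Polynomial.coeff_coe,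
      Polynomial.coeff_zero_eq_eval_zero, Polynomial.eval_prod] at h1
    simpa using h1
  · have h1 := hb _ _ hWr (hFr _ _ (by positivity) (gaussNormLE_psiCp hf (N + 1)))
    convert h1 using 1
    have h2 : ∏ z ∈ W, (‖z‖ / (p : ℝ) ^ (N + 1)) =
        (∏ n ∈ Finset.range N, ((p : ℝ) ^ (n + 1)) ^ ((p ^ f) ^ n * (p ^ f - 1))) /
          ((p : ℝ) ^ (N + 1)) ^ ((p ^ f) ^ N - 1) := by
      rw [Finset.prod_div_distrib, Finset.prod_const]
      congr 1
      · rw [hW, Finset.prod_biUnion hdisj]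
        refine Finset.prod_congr rfl fun n _ => ?_
        rw [Finset.prod_congr rfl fun z hz => (of_mem_zeroFinset hf hz).2.1, Finset.prod_const,
          card_zeroFinset]
      · congr 1
        rw [hW, Finset.card_biUnion (fun m _ n _ hmn => disjoint_zeroFinset hf hmn),
          Finset.sum_congr rfl fun n _ => card_zeroFinset hf n, ← Finset.sum_mul,
          Nat.geomSum_eq hq, Nat.div_mul_cancel]
        simpa using Nat.sub_dvd_pow_sub_pow (p ^ f) 1 N
    have h3 := pow_psiGrowth_mul_prod (q := p ^ f) (by omega) (p : ℝ) N
    have h4 : (p ^ f) ^ N = (p ^ f) ^ N - 1 + 1 :=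
      (Nat.sub_add_cancel (Nat.one_le_pow _ _ (by omega))).symm
    rw [h4, pow_succ] at h3
    rw [h2, div_mul_div_comm, h3, mul_comm, div_self (by positivity)]

theorem norm_evalCp_sub_one_le {Q : ℂ_[p]⟦X⟧} (hQ : IsEntire Q) (h0 : PowerSeries.coeff 0 Q = 1)
    {r : ℝ} (h : GaussNormLE Q r 1) {x : ℂ_[p]} (hr : 0 < r) (hx : ‖x‖ ≤ r) :
    ‖evalCp Q x - 1‖ ≤ ‖x‖ / r := by
  have h1 := (hQ x).hasSum.sub (hasSum_ite_eq 0 (1 : ℂ_[p]))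
  rw [← evalCp] at h1
  rw [← h1.tsum_eq]
  refine IsUltrametricDist.norm_tsum_le_of_forall_le fun k => ?_
  cases k with
  | zero => simp only [if_true, h0, pow_zero, mul_one, sub_self, norm_zero]; positivity
  | succ k =>
    rw [if_neg (by omega), sub_zero]
    refine (h.norm_term_le hr x _).trans ?_
    rw [one_mul, pow_succ]
    exact mul_le_of_le_one_left (by positivity)
      (pow_le_one₀ (by positivity) ((div_le_one hr).mpr hx))

theorem evalCp_ne_zero_of_norm_lt {Q : ℂ_[p]⟦X⟧} (hQ : IsEntire Q)
    (h0 : PowerSeries.coeff 0 Q = 1) {r : ℝ} (h : GaussNormLE Q r 1) {x : ℂ_[p]}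
    (hx : ‖x‖ < r) : evalCp Q x ≠ 0 := by
  intro h1
  have hr : 0 < r := (norm_nonneg x).trans_lt hx
  have h2 := norm_evalCp_sub_one_le hQ h0 h hr hx.le
  rw [h1, zero_sub, norm_neg, norm_one] at h2
  exact absurd h2 (not_le.mpr ((div_lt_one hr).mpr hx))

theorem eval_zeroFactor_eq_zero_iff (hf : 0 < f) {n : ℕ} {x : ℂ_[p]} :
    (zeroFactor p hf n).eval x = 0 ↔ x ∈ zeroFinset p hf n := by
  rw [zeroFactor, eval_prod_linear_eq_zero_iff]
  constructor
  · rintro ⟨z, hz, hzx⟩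
    have hz0 := ne_zero_of_mem_zeroFinset hf hz
    have : x = z := by field_simp at hzx; exact hzx
    rwa [this]
  · exact fun hx => ⟨x, hx, inv_mul_cancel₀ (ne_zero_of_mem_zeroFinset hf hx)⟩

theorem psiZeros_succ (hf : 0 < f) (n : ℕ) : psiZeros p f (n + 1) = zeroFinset p hf n := by
  have hp := one_lt_prime_real (p := p)
  ext x
  constructor
  · rintro ⟨hx, hx0⟩
    obtain ⟨Q, hΨ, hQ, hQ0, hQ1⟩ := exists_psi_eq_prod_mul (p := p) hf (n + 1)
    have hQx : evalCp Q x ≠ 0 := evalCp_ne_zero_of_norm_lt hQ hQ0 hQ1 (by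
      rw [hx]
      exact pow_lt_pow_right₀ hp (by omega))
    rw [hΨ, (IsEntire.coe _).evalCp_mul hQ, evalCp_coe, Polynomial.eval_mul, Polynomial.eval_X,
      Polynomial.eval_prod] at hx0
    rcases mul_eq_zero.mp ((mul_eq_zero.mp hx0).resolve_right hQx) with h | h
    · rw [h, norm_zero] at hx
      exact absurd hx.symm (pow_pos (zero_lt_one.trans hp) _).ne'
    · obtain ⟨m, -, hm⟩ := Finset.prod_eq_zero_iff.mp h
      have hxm := (eval_zeroFactor_eq_zero_iff hf).mp hm
      have h1 := (of_mem_zeroFinset hf hxm).2.1.symm.trans hx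
      have := (pow_right_injective₀ (zero_lt_one.trans hp) hp.ne') h1
      rwa [show n = m by omega]
  · exact fun hx => (of_mem_zeroFinset hf hx).2

theorem psiFactor_succ (hf : 0 < f) (n : ℕ) : psiFactor p f (n + 1) = zeroFactor p hf n := by
  rw [psiFactor, psiZeros_succ hf, finprod_mem_coe_finset, zeroFactor]

theorem isSimpleZero_of_mem_zeroFinset (hf : 0 < f) {n : ℕ} {z : ℂ_[p]}
    (hz : z ∈ zeroFinset p hf n) : IsSimpleZero (psiCp p f) z := by
  classical
  have hz0 := ne_zero_of_mem_zeroFinset hf hz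
  obtain ⟨Q, hΨ, hQ, hQ0, hQ1⟩ := exists_psi_eq_prod_mul (p := p) hf (n + 1)
  have hQz : evalCp Q z ≠ 0 := evalCp_ne_zero_of_norm_lt hQ hQ0 hQ1 (by
    rw [(of_mem_zeroFinset hf hz).2.1]
    exact pow_lt_pow_right₀ one_lt_prime_real (by omega))
  set P : ℂ_[p][X] := ∏ w ∈ (zeroFinset p hf n).erase z, (1 - Polynomial.C w⁻¹ * Polynomial.X)
    with hP
  set R : ℂ_[p][X] := Polynomial.X * (∏ m ∈ Finset.range n, zeroFactor p hf m) * P with hR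
  have hsplit : Polynomial.X * ∏ m ∈ Finset.range (n + 1), zeroFactor p hf m =
      (1 - Polynomial.C z⁻¹ * Polynomial.X) * R := by
    rw [Finset.prod_range_succ, zeroFactor.eq_def p hf n, ← Finset.mul_prod_erase _ _ hz, hR]
    ring
  have hRz : R.eval z ≠ 0 := by
    rw [hR, Polynomial.eval_mul, Polynomial.eval_mul, Polynomial.eval_X, Polynomial.eval_prod]
    refine mul_ne_zero (mul_ne_zero hz0 (Finset.prod_ne_zero_iff.mpr fun m hm h => ?_)) fun h => ?_
    · have hzm := (eval_zeroFactor_eq_zero_iff hf).mp h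
      exact Finset.disjoint_left.mp (disjoint_zeroFinset hf (Finset.mem_range.mp hm).ne) hzm hz
    · obtain ⟨w, hw, hwz⟩ := eval_prod_linear_eq_zero_iff.mp h
      obtain ⟨hwz', hw⟩ := Finset.mem_erase.mp hw
      have hw0 := ne_zero_of_mem_zeroFinset hf hw
      exact hwz' (by field_simp at hwz; exact hwz.symm)
  refine isSimpleZero_of_eq_linear_mul (Q := (R : ℂ_[p]⟦X⟧) * Q) hz0 ?_ ((IsEntire.coe _).mul hQ) ?_
  · rw [hΨ, hsplit, Polynomial.coe_mul, mul_assoc]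
  · rw [(IsEntire.coe _).evalCp_mul hQ, evalCp_coe]
    exact mul_ne_zero hRz hQz

/-! ### The factors `ψ_n` and the product -/

theorem zeroFactor_eq (hf : 0 < f) (n : ℕ) : ∃ g : (Zq p f)[X], zeroFactor p hf n =
    1 + Polynomial.C ((p : ℂ_[p]) ^ (n + 1)) * Polynomial.X * g.map (Zq p f).subtype := by
  classical
  have hp := one_lt_prime_real (p := p)
  have hpos : (0 : ℝ) < p := zero_lt_one.trans hp
  have key : ∀ S : Finset ℂ_[p], S ⊆ zeroFinset p hf n → ∃ g : (Zq p f)[X],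
      ∏ z ∈ S, (1 - Polynomial.C z⁻¹ * Polynomial.X) =
        1 + Polynomial.C ((p : ℂ_[p]) ^ (n + 1)) * Polynomial.X * g.map (Zq p f).subtype := by
    intro S
    induction S using Finset.induction_on with
    | empty => exact fun _ => ⟨0, by simp⟩
    | insert z S hzS ih =>
      intro hS
      obtain ⟨g, hg⟩ := ih ((Finset.subset_insert _ _).trans hS)
      obtain ⟨hzm, hzn, -⟩ := of_mem_zeroFinset hf (hS (Finset.mem_insert_self _ _))
      have hu : ((p : ℂ_[p]) ^ (n + 1) * z)⁻¹ ∈ Zq p f := by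
        refine ⟨inv_mem (mul_mem (pow_mem (natCast_mem _ p) _) hzm), ?_⟩
        rw [norm_inv, norm_mul, norm_pow, norm_natCast_prime, hzn, inv_pow,
          inv_mul_cancel₀ (by positivity), inv_one]
      have hzu : z⁻¹ = (p : ℂ_[p]) ^ (n + 1) * ((p : ℂ_[p]) ^ (n + 1) * z)⁻¹ := by
        have hp0 : (p : ℂ_[p]) ^ (n + 1) ≠ 0 := pow_ne_zero _ natCast_prime_ne_zero
        rw [mul_inv, mul_inv_cancel_left₀ hp0]
      obtain ⟨c, hc⟩ : ∃ c : Zq p f, (Zq p f).subtype c = (p : ℂ_[p]) ^ (n + 1) :=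
        ⟨p ^ (n + 1), by rw [map_pow, map_natCast]⟩
      refine ⟨g - Polynomial.C ⟨_, hu⟩ - Polynomial.C ⟨_, hu⟩ * Polynomial.C c *
        Polynomial.X * g, ?_⟩
      rw [Finset.prod_insert hzS, hg, hzu]
      simp only [Polynomial.map_sub, Polynomial.map_mul, Polynomial.map_C, Polynomial.map_X, hc,
        Subring.subtype_apply, Polynomial.C_mul]
      ring
  exact key _ (Finset.Subset.refl _)

theorem natDegree_zeroFactor (hf : 0 < f) (n : ℕ) :
    (zeroFactor p hf n).natDegree = (zeroFinset p hf n).card ∧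
      (zeroFactor p hf n).leadingCoeff = ∏ z ∈ zeroFinset p hf n, -z⁻¹ := by
  have h1 : ∀ z ∈ zeroFinset p hf n, (1 - Polynomial.C z⁻¹ * Polynomial.X : ℂ_[p][X]).natDegree = 1 ∧
      (1 - Polynomial.C z⁻¹ * Polynomial.X : ℂ_[p][X]).leadingCoeff = -z⁻¹ := by
    intro z hz
    have hz0 : -z⁻¹ ≠ 0 := neg_ne_zero.mpr (inv_ne_zero (ne_zero_of_mem_zeroFinset hf hz))
    have h2 : (1 - Polynomial.C z⁻¹ * Polynomial.X : ℂ_[p][X]) =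
        Polynomial.C (-z⁻¹) * Polynomial.X + Polynomial.C 1 := by
      rw [Polynomial.C_neg, Polynomial.C_1]
      ring
    rw [h2]
    exact ⟨Polynomial.natDegree_linear hz0, Polynomial.leadingCoeff_linear hz0⟩
  constructor
  · rw [zeroFactor, Polynomial.natDegree_prod, Finset.sum_congr rfl fun z hz => (h1 z hz).1]
    · simp
    · intro z hz h
      have := (h1 z hz).1
      rw [h] at this
      simp at this
  · rw [zeroFactor, Polynomial.leadingCoeff_prod, Finset.prod_congr rfl fun z hz => (h1 z hz).2]

/-- A field automorphism of `ℚ_q` over `ℚ_p` preserves the condition `‖x‖ < 1`, which says that the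
powers of `x` tend to zero. -/
theorem norm_algEquiv_lt_one (hf : 0 < f) (σ : Gal(Qq p f/ℚ_[p])) {x : Qq p f}
    (hx : ‖(x : ℂ_[p])‖ < 1) : ‖(σ x : ℂ_[p])‖ < 1 := by
  have := finiteDimensional_Qq (p := p) hf
  have hcont : Continuous σ :=
    LinearMap.continuous_of_finiteDimensional (σ : Qq p f →ₐ[ℚ_[p]] Qq p f).toLinearMap
  have h1 : Filter.Tendsto (fun k : ℕ => x ^ k) Filter.atTop (nhds 0) := by
    rw [tendsto_subtype_rng]
    simpa using tendsto_pow_atTop_nhds_zero_of_norm_lt_one hx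
  have h2 := (hcont.tendsto 0).comp h1
  rw [map_zero, tendsto_subtype_rng] at h2
  have h3 := h2.norm
  simp only [Function.comp_apply, map_pow, SubmonoidClass.coe_pow, norm_pow,
    ZeroMemClass.coe_zero, norm_zero] at h3
  simpa using tendsto_pow_atTop_nhds_zero_iff.mp h3

theorem norm_algEquiv_eq_one (hf : 0 < f) (σ : Gal(Qq p f/ℚ_[p])) {x : Qq p f}
    (hx : ‖(x : ℂ_[p])‖ = 1) : ‖(σ x : ℂ_[p])‖ = 1 := by
  have hx0 : x ≠ 0 := by
    rintro rfl
    simp at hx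
  rcases lt_trichotomy ‖(σ x : ℂ_[p])‖ 1 with h | h | h
  · have h1 := norm_algEquiv_lt_one hf σ.symm h
    rw [AlgEquiv.symm_apply_apply] at h1
    exact absurd hx h1.ne
  · exact h
  · have h1 : ‖((σ x⁻¹ : Qq p f) : ℂ_[p])‖ < 1 := by
      rw [map_inv₀, IntermediateField.coe_inv, norm_inv]
      exact inv_lt_one_of_one_lt₀ h
    have h2 := norm_algEquiv_lt_one hf σ.symm h1
    rw [AlgEquiv.symm_apply_apply, IntermediateField.coe_inv, norm_inv, hx, inv_one] at h2
    exact absurd h2 (lt_irrefl _)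

theorem evalCp_psiCp_algEquiv (hf : 0 < f) (σ : Gal(Qq p f/ℚ_[p])) {z : Qq p f}
    (hz : evalCp (psiCp p f) z = 0) : evalCp (psiCp p f) (σ z) = 0 := by
  have := finiteDimensional_Qq (p := p) hf
  have hcont : Continuous σ :=
    LinearMap.continuous_of_finiteDimensional (σ : Qq p f →ₐ[ℚ_[p]] Qq p f).toLinearMap
  have hcoe : ∀ (w : Qq p f) (K : ℕ), ((∑ k ∈ Finset.range K,
      ((PowerSeries.coeff k (psi p (p ^ f)) : ℤ) : Qq p f) * w ^ k : Qq p f) : ℂ_[p]) =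
      ∑ k ∈ Finset.range K, PowerSeries.coeff k (psiCp p f) * (w : ℂ_[p]) ^ k := by
    intro w K
    rw [AddSubmonoidClass.coe_finsetSum]
    refine Finset.sum_congr rfl fun k _ => ?_
    rw [coeff_psiCp]
    simp
  have h1 : Filter.Tendsto (fun K : ℕ => ∑ k ∈ Finset.range K,
      ((PowerSeries.coeff k (psi p (p ^ f)) : ℤ) : Qq p f) * z ^ k) Filter.atTop (nhds 0) := by
    rw [tendsto_subtype_rng]
    simp only [hcoe]
    have := (isEntire_psiCp hf (z : ℂ_[p])).hasSum.tendsto_sum_nat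
    rw [← evalCp, hz] at this
    exact this
  have h2 := (hcont.tendsto 0).comp h1
  rw [map_zero, tendsto_subtype_rng] at h2
  simp only [Function.comp_apply, map_sum, map_mul, map_intCast, map_pow, hcoe] at h2
  exact tendsto_nhds_unique (isEntire_psiCp hf (σ z : ℂ_[p])).hasSum.tendsto_sum_nat h2

/-- The automorphisms of `ℚ_q` over `ℚ_p` permute the zeros of `Ψ_q` of given valuation. -/
theorem algEquiv_mem_zeroFinset (hf : 0 < f) {n : ℕ} (σ : Gal(Qq p f/ℚ_[p])) {z : Qq p f}
    (hz : (z : ℂ_[p]) ∈ zeroFinset p hf n) : (σ z : ℂ_[p]) ∈ zeroFinset p hf n := by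
  have hpos : (0 : ℝ) < p := zero_lt_one.trans one_lt_prime_real
  have hnorm : ∀ w : ℂ_[p], ‖(p : ℂ_[p]) ^ (n + 1) * w‖ = 1 ↔ ‖w‖ = (p : ℝ) ^ (n + 1) := by
    intro w
    rw [norm_mul, norm_pow, norm_natCast_prime, inv_pow, inv_mul_eq_one₀ (by positivity), eq_comm]
  obtain ⟨-, hz1, hz2⟩ := of_mem_zeroFinset hf hz
  rw [← Finset.mem_coe, ← psiZeros_succ hf]
  refine ⟨(hnorm _).mp ?_, evalCp_psiCp_algEquiv hf σ hz2⟩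
  have h1 := norm_algEquiv_eq_one hf σ (x := (p : Qq p f) ^ (n + 1) * z)
    (by simpa using (hnorm _).mpr hz1)
  simpa using h1

theorem exists_map_eq_zeroFactor (hf : 0 < f) (n : ℕ) :
    ∃ P : ℚ_[p][X], P.map (algebraMap ℚ_[p] ℂ_[p]) = zeroFactor p hf n := by
  classical
  have := finiteDimensional_Qq (p := p) hf
  have := isGalois_Qq (p := p) hf
  set S : Finset (Qq p f) := (zeroFinset p hf n).subtype (· ∈ Qq p f) with hS
  have hmem : ∀ z : Qq p f, z ∈ S ↔ (z : ℂ_[p]) ∈ zeroFinset p hf n := fun z => by simp [hS]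
  set G : (Qq p f)[X] := ∏ z ∈ S, (1 - Polynomial.C z⁻¹ * Polynomial.X) with hG
  have hGmap : G.map (algebraMap (Qq p f) ℂ_[p]) = zeroFactor p hf n := by
    rw [hG, Polynomial.map_prod, zeroFactor]
    refine Finset.prod_bij (fun z _ => (z : ℂ_[p])) (fun z hz => (hmem z).mp hz)
      (fun _ _ _ _ h => Subtype.ext h)
      (fun z hz => ⟨⟨z, (of_mem_zeroFinset hf hz).1⟩, (hmem _).mpr hz, rfl⟩) fun z _ => ?_
    simp
  have hfix : ∀ σ : Gal(Qq p f/ℚ_[p]), G.map (σ : Qq p f →+* Qq p f) = G := by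
    intro σ
    rw [hG, Polynomial.map_prod]
    refine Finset.prod_bij (fun z _ => σ z)
      (fun z hz => (hmem _).mpr (algEquiv_mem_zeroFinset hf σ ((hmem z).mp hz)))
      (fun _ _ _ _ h => σ.injective h)
      (fun z hz => ⟨σ.symm z, (hmem _).mpr (algEquiv_mem_zeroFinset hf σ.symm ((hmem z).mp hz)),
        σ.apply_symm_apply z⟩) fun z _ => ?_
    simp
  have hlift : G ∈ Polynomial.lifts (algebraMap ℚ_[p] (Qq p f)) := by
    rw [Polynomial.lifts_iff_coeff_lifts]
    intro i
    rw [IsGalois.mem_range_algebraMap_iff_fixed]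
    intro σ
    conv_rhs => rw [← hfix σ]
    simp
  obtain ⟨P, hP⟩ := (Polynomial.mem_lifts _).mp hlift
  refine ⟨P, ?_⟩
  rw [← hGmap, ← hP, Polynomial.map_map, ← IsScalarTower.algebraMap_eq]

theorem coeff_zero_zeroFactor (hf : 0 < f) (n : ℕ) : (zeroFactor p hf n).coeff 0 = 1 := by
  rw [Polynomial.coeff_zero_eq_eval_zero, zeroFactor, Polynomial.eval_prod]
  simp

theorem gaussNormLE_prod {ι : Type*} (S : Finset ι) (F : ι → ℂ_[p][X]) {r : ℝ} (hr : 0 < r)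
    (h : ∀ i ∈ S, GaussNormLE (F i : ℂ_[p]⟦X⟧) r 1) :
    GaussNormLE ((∏ i ∈ S, F i : ℂ_[p][X]) : ℂ_[p]⟦X⟧) r 1 := by
  classical
  induction S using Finset.induction_on with
  | empty => simpa using GaussNormLE.one
  | insert i S hi ih =>
    rw [Finset.prod_insert hi, Polynomial.coe_mul]
    simpa using (h i (Finset.mem_insert_self _ _)).mul
      (ih fun j hj => h j (Finset.mem_insert_of_mem hj)) hr

theorem gaussNormLE_zeroFactor (hf : 0 < f) (n : ℕ) :
    GaussNormLE (zeroFactor p hf n : ℂ_[p]⟦X⟧) ((p : ℝ) ^ (n + 1)) 1 := by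
  have hpos : (0 : ℝ) < p := zero_lt_one.trans one_lt_prime_real
  refine gaussNormLE_prod _ _ (by positivity) fun z hz k => ?_
  rw [Polynomial.coeff_coe]
  match k with
  | 0 => simp
  | 1 => simp [Polynomial.coeff_one, (of_mem_zeroFinset hf hz).2.1, hpos.ne']
  | k + 2 => simp [Polynomial.coeff_one]

theorem isExtremal_of_map_eq_zeroFactor (hf : 0 < f) {n : ℕ} {P : ℚ_[p][X]}
    (hP : P.map (algebraMap ℚ_[p] ℂ_[p]) = zeroFactor p hf n) :
    P.coeff 0 = 1 ∧ IsExtremal P ((p : ℝ) ^ (n + 1)) := by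
  have hpos : (0 : ℝ) < p := zero_lt_one.trans one_lt_prime_real
  have hcoeff : ∀ i, algebraMap ℚ_[p] ℂ_[p] (P.coeff i) = (zeroFactor p hf n).coeff i := fun i => by
    rw [← hP, Polynomial.coeff_map]
  have hnorm : ∀ i, ‖P.coeff i‖ = ‖(zeroFactor p hf n).coeff i‖ := fun i => by
    rw [← hcoeff, norm_algebraMap']
  have h0 : P.coeff 0 = 1 := by
    apply (algebraMap ℚ_[p] ℂ_[p]).injective
    rw [hcoeff, coeff_zero_zeroFactor, map_one]
  have hdeg : P.natDegree = (zeroFactor p hf n).natDegree := by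
    rw [← hP, Polynomial.natDegree_map]
  refine ⟨h0, fun h => by simp [h] at h0, fun i => ?_, ?_⟩
  · rw [h0, norm_one, hnorm]
    simpa using gaussNormLE_zeroFactor hf n i
  · rw [Polynomial.leadingCoeff, hnorm, hdeg, ← Polynomial.leadingCoeff,
      (natDegree_zeroFactor hf n).1, (natDegree_zeroFactor hf n).2, h0, norm_one, norm_prod,
      Finset.prod_congr rfl fun z hz => by
        rw [norm_neg, norm_inv, (of_mem_zeroFinset hf hz).2.1], Finset.prod_const, ← mul_pow,
      inv_mul_cancel₀ (by positivity), one_pow]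

/-- If the finite set `s` contains `0, …, N - 1`, the product of `x` and the factors with index in `s`
is close to `Ψ_q(x)`: both arise from the product of the first `N` factors by multiplication with a
series of constant term `1` and Gauss norm `1` on the disc of radius `p ^ (N + 1)`. -/
theorem norm_psi_sub_prod_le (hf : 0 < f) {N : ℕ} {s : Finset ℕ} (hs : Finset.range N ⊆ s)
    {x : ℂ_[p]} (hx : ‖x‖ ≤ (p : ℝ) ^ N) :
    ‖evalCp (psiCp p f) x - x * ∏ n ∈ s, (zeroFactor p hf n).eval x‖ ≤
      ‖evalCp (psiCp p f) x‖ * (‖x‖ / (p : ℝ) ^ (N + 1)) := by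
  have hp := one_lt_prime_real (p := p)
  have hpos : (0 : ℝ) < p := zero_lt_one.trans hp
  have hr : (0 : ℝ) < (p : ℝ) ^ (N + 1) := by positivity
  have hlt : ‖x‖ < (p : ℝ) ^ (N + 1) := hx.trans_lt (pow_lt_pow_right₀ hp (by omega))
  obtain ⟨Q, hΨ, hQ, hQ0, hQ1⟩ := exists_psi_eq_prod_mul (p := p) hf N
  set A : ℂ_[p] := x * ∏ n ∈ Finset.range N, (zeroFactor p hf n).eval x with hA
  set B : ℂ_[p][X] := ∏ n ∈ s \ Finset.range N, zeroFactor p hf n with hB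
  have hΨx : evalCp (psiCp p f) x = A * evalCp Q x := by
    rw [hΨ, (IsEntire.coe _).evalCp_mul hQ, evalCp_coe, Polynomial.eval_mul, Polynomial.eval_X,
      Polynomial.eval_prod]
  have hsx : x * ∏ n ∈ s, (zeroFactor p hf n).eval x = A * evalCp (B : ℂ_[p]⟦X⟧) x := by
    rw [hA, ← Finset.prod_sdiff hs, evalCp_coe, hB, Polynomial.eval_prod]
    ring
  have hB1 : ‖evalCp (B : ℂ_[p]⟦X⟧) x - 1‖ ≤ ‖x‖ / (p : ℝ) ^ (N + 1) := by
    refine norm_evalCp_sub_one_le (IsEntire.coe B) ?_ ?_ hr hlt.le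
    · rw [Polynomial.coeff_coe, Polynomial.coeff_zero_eq_eval_zero, hB, Polynomial.eval_prod]
      refine Finset.prod_eq_one fun n _ => ?_
      rw [← Polynomial.coeff_zero_eq_eval_zero, coeff_zero_zeroFactor]
    · refine gaussNormLE_prod _ _ hr fun n hn => ?_
      refine (gaussNormLE_zeroFactor hf n).mono_radius hr.le (pow_le_pow_right₀ hp.le ?_)
      have := (Finset.mem_sdiff.mp hn).2
      rw [Finset.mem_range] at this
      omega
  have hQx := norm_evalCp_sub_one_le hQ hQ0 hQ1 hr hlt.le
  have hQn : ‖evalCp Q x‖ = 1 := by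
    have h1 : ‖evalCp Q x - 1‖ < ‖(1 : ℂ_[p])‖ := by
      rw [norm_one]
      exact hQx.trans_lt ((div_lt_one hr).mpr hlt)
    rw [← sub_add_cancel (evalCp Q x) 1,
      IsUltrametricDist.norm_add_eq_max_of_norm_ne_norm h1.ne, max_eq_right h1.le, norm_one]
  rw [hΨx, hsx, ← mul_sub, norm_mul A, norm_mul A, hQn, mul_one]
  refine mul_le_mul_of_nonneg_left ?_ (norm_nonneg _)
  rw [← sub_sub_sub_cancel_right _ _ 1]
  exact (norm_sub_le_max' _ _).trans (max_le hQx hB1)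

theorem tendstoUniformlyOn_prod_zeroFactor (hf : 0 < f) (R : ℝ) : TendstoUniformlyOn
    (fun (s : Finset ℕ) (x : ℂ_[p]) => x * ∏ n ∈ s, (zeroFactor p hf n).eval x)
    (evalCp (psiCp p f)) Filter.atTop (Metric.closedBall 0 R) := by
  have hp := one_lt_prime_real (p := p)
  have hpos : (0 : ℝ) < p := zero_lt_one.trans hp
  obtain ⟨m, hm⟩ := pow_unbounded_of_one_lt R hp
  have hM := gaussNormLE_psiCp (p := p) hf m
  set M : ℝ := (p : ℝ) ^ psiGrowth (p ^ f) m
  rw [Metric.tendstoUniformlyOn_iff]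
  intro ε hε
  obtain ⟨N, hN⟩ := pow_unbounded_of_one_lt (M / ε) hp
  filter_upwards [Filter.eventually_ge_atTop (Finset.range (m + N))] with s hs x hx
  have hxm : ‖x‖ ≤ (p : ℝ) ^ m := (mem_closedBall_zero_iff.mp hx).trans hm.le
  have h1 := norm_psi_sub_prod_le hf hs (hxm.trans (pow_le_pow_right₀ hp.le (Nat.le_add_right m N)))
  rw [dist_eq_norm]
  calc _ ≤ _ := h1
    _ ≤ M * ((p : ℝ) ^ m / (p : ℝ) ^ (m + N)) := by
        have h2 : (p : ℝ) ^ (m + N) ≤ (p : ℝ) ^ (m + N + 1) :=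
          pow_le_pow_right₀ hp.le (Nat.le_succ _)
        exact mul_le_mul (hM.norm_evalCp_le hxm)
          (div_le_div₀ (by positivity) hxm (by positivity) h2) (by positivity) hM.nonneg
    _ = M / (p : ℝ) ^ N := by
        rw [pow_add]
        field_simp
    _ < ε := by
        rw [div_lt_iff₀ hε] at hN
        rw [div_lt_iff₀ (by positivity), mul_comm]
        exact hN

end Zeros

/-! ### The inverse series `β_q` -/

section Inverse

variable {p : ℕ}

/-- The series `p Ψ_q(T / p)`, which has integral coefficients. -/
noncomputable def scaledPsi (p q : ℕ) : ℤ⟦X⟧ :=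
  PowerSeries.mk fun k => PowerSeries.coeff k (PowerSeries.X : ℤ⟦X⟧) -
    ∑ j ∈ Finset.Icc 1 k, (p : ℤ) ^ ((j - 1) * (k - 1)) * PowerSeries.coeff k (psi p q ^ (q ^ j))

theorem pow_mul_coeff_scaledPsi {q : ℕ} (hq : 2 ≤ q) (k : ℕ) :
    (p : ℤ) ^ k * PowerSeries.coeff k (scaledPsi p q) = p * PowerSeries.coeff k (psi p q) := by
  conv_rhs => rw [← psiStep_psi p hq]
  rw [scaledPsi, psiStep, PowerSeries.coeff_mk, PowerSeries.coeff_mk, mul_sub, mul_sub,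
    Finset.mul_sum, Finset.mul_sum]
  congr 1
  · rw [PowerSeries.coeff_X]
    split_ifs with hk
    · rw [hk, pow_one]
    · simp
  · refine Finset.sum_congr rfl fun j hj => ?_
    obtain ⟨hj1, hjk⟩ := Finset.mem_Icc.mp hj
    obtain ⟨i, rfl⟩ := Nat.exists_eq_add_of_le' hj1
    obtain ⟨l, rfl⟩ := Nat.exists_eq_add_of_le' (hj1.trans hjk)
    rw [← mul_assoc, ← mul_assoc, Nat.add_sub_cancel, Nat.add_sub_cancel]
    congr 1
    ring

theorem constantCoeff_scaledPsi (q : ℕ) : PowerSeries.constantCoeff (scaledPsi p q) = 0 := by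
  rw [← PowerSeries.coeff_zero_eq_constantCoeff_apply, scaledPsi, PowerSeries.coeff_mk]
  simp

theorem rescale_scaledPsi {q : ℕ} (hq : 2 ≤ q) :
    PowerSeries.rescale (p : ℤ) (scaledPsi p q) = PowerSeries.C (p : ℤ) * psi p q := by
  ext k
  rw [PowerSeries.coeff_rescale, pow_mul_coeff_scaledPsi hq, PowerSeries.coeff_C_mul]

variable [Fact p.Prime] {f : ℕ}

theorem map_psi_zmod {q : ℕ} (hq : 2 ≤ q) :
    (psi p q).map (Int.castRingHom (ZMod p)) = PowerSeries.X := by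
  ext k
  rw [PowerSeries.coeff_map]
  conv_lhs => rw [← psiStep_psi p hq, psiStep, PowerSeries.coeff_mk, map_sub, map_sum]
  rcases Nat.lt_or_ge k 2 with hk | hk
  · have h0 : ∀ j ∈ Finset.Icc 1 k, PowerSeries.coeff k (psi p q ^ q ^ j) = 0 := by
      intro j hj
      have hX : (PowerSeries.X : ℤ⟦X⟧) ∣ psi p q := by
        rw [PowerSeries.X_dvd_iff, ← PowerSeries.coeff_zero_eq_constantCoeff_apply]
        exact (isPsi_psi (Fact.out : p.Prime).ne_zero hq).1
      refine PowerSeries.X_pow_dvd_iff.mp (pow_dvd_pow_of_dvd hX (q ^ j)) k (hk.trans_le ?_)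
      exact hq.trans (Nat.le_self_pow (by have := Finset.mem_Icc.mp hj; omega) q)
    rw [Finset.sum_eq_zero fun j hj => by rw [h0 j hj, mul_zero, map_zero]]
    simp [PowerSeries.coeff_X]
  · rw [Finset.sum_eq_zero fun j hj => ?_]
    · simp [PowerSeries.coeff_X]
    · have : j * (k - 1) ≠ 0 := by
        have := Finset.mem_Icc.mp hj
        exact Nat.mul_ne_zero (by omega) (by omega)
      simp [this]

theorem coeff_one_scaledPsi {q : ℕ} (hq : 2 ≤ q) : PowerSeries.coeff 1 (scaledPsi p q) = 1 := by
  have h1 := pow_mul_coeff_scaledPsi (p := p) hq 1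
  rw [(isPsi_psi (Fact.out : p.Prime).ne_zero hq).2.1, pow_one] at h1
  exact mul_left_cancel₀ (by exact_mod_cast (Fact.out : p.Prime).ne_zero) h1

theorem map_scaledPsi_zmod {q : ℕ} (hq : 2 ≤ q) :
    (scaledPsi p q).map (Int.castRingHom (ZMod p)) = PowerSeries.X - PowerSeries.X ^ q := by
  ext k
  have hpow : ((PowerSeries.coeff k (psi p q ^ q) : ℤ) : ZMod p) =
      PowerSeries.coeff k (PowerSeries.X ^ q : (ZMod p)⟦X⟧) := by
    rw [← map_psi_zmod (p := p) hq, ← map_pow, PowerSeries.coeff_map]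
    simp
  rw [PowerSeries.coeff_map, map_sub]
  match k with
  | 0 =>
    rw [PowerSeries.coeff_zero_eq_constantCoeff_apply, constantCoeff_scaledPsi]
    simp [PowerSeries.coeff_zero_eq_constantCoeff_apply, show 0 ≠ q by omega]
  | 1 =>
    rw [coeff_one_scaledPsi hq]
    simp [PowerSeries.coeff_X_pow, show 1 ≠ q by omega]
  | k + 2 =>
    rw [scaledPsi, PowerSeries.coeff_mk, map_sub, map_sum, Finset.sum_eq_single 1]
    · simp [PowerSeries.coeff_X, hpow]
    · intro j hj hj1
      have : (j - 1) * (k + 2 - 1) ≠ 0 := by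
        have := Finset.mem_Icc.mp hj
        exact Nat.mul_ne_zero (by omega) (by omega)
      rw [map_mul, map_pow, eq_intCast, Int.cast_natCast, ZMod.natCast_self, zero_pow this, zero_mul]
    · simp

theorem hasSubst_of_constantCoeff {R : Type*} [CommRing R] {F : R⟦X⟧}
    (h : PowerSeries.constantCoeff F = 0) : PowerSeries.HasSubst F :=
  PowerSeries.HasSubst.of_constantCoeff_zero' h

/-- Rescaling the variable commutes with compositional inversion. -/
theorem rescale_eq_C_mul_of_subst_eq_X {R : Type*} [CommRing R] {F G β γ : R⟦X⟧} {c : R}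
    (hFG : PowerSeries.rescale c G = PowerSeries.C c * F) (hG : PowerSeries.constantCoeff G = 0)
    (hβ : PowerSeries.constantCoeff β = 0) (hFβ : F.subst β = (PowerSeries.X : R⟦X⟧))
    (hγG : γ.subst G = (PowerSeries.X : R⟦X⟧)) : PowerSeries.rescale c γ = PowerSeries.C c * β := by
  rw [← PowerSeries.smul_eq_C_mul] at hFG ⊢
  have sβ := hasSubst_of_constantCoeff hβ
  have scβ : PowerSeries.HasSubst (c • β) := hasSubst_of_constantCoeff (by simp [hβ])
  have scX : PowerSeries.HasSubst (c • PowerSeries.X : R⟦X⟧) := PowerSeries.HasSubst.smul_X' c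
  have sG := hasSubst_of_constantCoeff hG
  have h1 : G.subst (c • β) = c • (PowerSeries.X : R⟦X⟧) := by
    rw [← hFβ, ← PowerSeries.subst_smul sβ, ← hFG, PowerSeries.rescale_eq_subst,
      PowerSeries.subst_comp_subst_apply scX sβ, PowerSeries.subst_smul sβ, PowerSeries.subst_X sβ]
  rw [PowerSeries.rescale_eq_subst, ← h1, ← PowerSeries.subst_comp_subst_apply sG scβ, hγG,
    PowerSeries.subst_X scβ]

/-- The inverse of `T - T ^ q` over `ℤ / p` is not a polynomial, by comparison of degrees. -/
theorem frequently_coeff_ne_zero {q : ℕ} (hq : 2 ≤ q) {γ : (ZMod p)⟦X⟧}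
    (h : γ - γ ^ q = PowerSeries.X) (N : ℕ) : ∃ k ≥ N, PowerSeries.coeff k γ ≠ 0 := by
  by_contra! h0
  obtain ⟨P, rfl⟩ : ∃ P : (ZMod p)[X], (P : (ZMod p)⟦X⟧) = γ := by
    refine ⟨PowerSeries.trunc N γ, ?_⟩
    ext k
    rw [Polynomial.coeff_coe, PowerSeries.coeff_trunc]
    split_ifs with hk
    · rfl
    · exact (h0 k (not_lt.mp hk)).symm
  have h1 : P - P ^ q = Polynomial.X := by
    apply Polynomial.coe_injective
    rw [Polynomial.coe_sub, Polynomial.coe_pow, h, Polynomial.coe_X]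
  have h2 := congrArg Polynomial.natDegree h1
  rw [Polynomial.natDegree_X] at h2
  have h3 : (P ^ q).natDegree = q * P.natDegree := Polynomial.natDegree_pow P q
  rcases Nat.eq_zero_or_pos P.natDegree with hd | hd
  · have := Polynomial.natDegree_sub_le P (P ^ q)
    rw [h2, h3, hd] at this
    simp at this
  · have h4 : P.natDegree < (P ^ q).natDegree := by
      rw [h3]
      nlinarith
    rw [Polynomial.natDegree_sub_eq_right_of_natDegree_lt h4, h3] at h2
    have : 2 * 1 ≤ q * P.natDegree := Nat.mul_le_mul hq hd
    omega

theorem norm_intCast_lt_one_iff (a : ℤ) : ‖(a : ℂ_[p])‖ < 1 ↔ (p : ℤ) ∣ a := by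
  rw [← Padic.norm_intCast_lt_one_iff, ← map_intCast (algebraMap ℚ_[p] ℂ_[p]), norm_algebraMap']

/-- The disc of convergence of `β = Ψ_q⁻¹`: with `p Ψ_q(T / p) = G` and `γ = G⁻¹` one has
`β = p⁻¹ γ(p T)`, and the reduction of `γ` modulo `p`, the inverse of `T - T ^ q`, is not a
polynomial. -/
theorem summable_inverse_iff (hf : 0 < f) {β : ℤ⟦X⟧} (hβ : PowerSeries.constantCoeff β = 0)
    (hΨβ : (psi p (p ^ f)).subst β = (PowerSeries.X : ℤ⟦X⟧)) (T : ℂ_[p]) :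
    (Summable fun k : ℕ => ((PowerSeries.coeff k β : ℤ) : ℂ_[p]) * T ^ k) ↔ ‖T‖ < (p : ℝ) := by
  have hp := one_lt_prime_real (p := p)
  have hpos : (0 : ℝ) < p := zero_lt_one.trans hp
  have hq := two_le_prime_pow (p := p) hf
  have hp0 := natCast_prime_ne_zero (p := p)
  have hu : IsUnit (PowerSeries.coeff 1 (scaledPsi p (p ^ f))) := by
    rw [coeff_one_scaledPsi hq]
    exact isUnit_one
  have hc := constantCoeff_scaledPsi (p := p) (p ^ f)
  set γ : ℤ⟦X⟧ := (scaledPsi p (p ^ f)).substInvOfIsUnit hu with hγ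
  have hγ0 : PowerSeries.constantCoeff γ = 0 := PowerSeries.constantCoeff_substInvOfIsUnit _ hu
  have hGγ : (scaledPsi p (p ^ f)).subst γ = (PowerSeries.X : ℤ⟦X⟧) :=
    PowerSeries.subst_substInvOfIsUnit_right _ hc hu
  have hγG : γ.subst (scaledPsi p (p ^ f)) = (PowerSeries.X : ℤ⟦X⟧) :=
    PowerSeries.subst_substInvOfIsUnit_left _ hc hu
  have hβγ := rescale_eq_C_mul_of_subst_eq_X (rescale_scaledPsi (p := p) hq) hc hβ hΨβ hγG
  have hcoeff : ∀ k : ℕ, (p : ℂ_[p]) * (((PowerSeries.coeff k β : ℤ) : ℂ_[p]) * T ^ k) =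
      ((PowerSeries.coeff k γ : ℤ) : ℂ_[p]) * (p * T) ^ k := by
    intro k
    have h1 := congrArg (fun F => ((PowerSeries.coeff k F : ℤ) : ℂ_[p])) hβγ
    simp only [PowerSeries.coeff_rescale, PowerSeries.coeff_C_mul, Int.cast_mul,
      Int.cast_pow, Int.cast_natCast] at h1
    rw [← mul_assoc, ← h1, mul_pow]
    ring
  have hpT : ‖(p : ℂ_[p]) * T‖ = ‖T‖ / p := by
    rw [norm_mul, norm_natCast_prime, div_eq_inv_mul]
  constructor
  · intro hs
    by_contra! hT
    have hpT1 : 1 ≤ ‖(p : ℂ_[p]) * T‖ := by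
      rw [hpT]
      exact (one_le_div hpos).mpr hT
    have h1 := (hs.mul_left (p : ℂ_[p])).tendsto_atTop_zero
    simp only [hcoeff] at h1
    obtain ⟨N, hN⟩ := Filter.eventually_atTop.mp
      ((tendsto_zero_iff_norm_tendsto_zero.mp h1).eventually_lt_const one_pos)
    have h2 : γ.map (Int.castRingHom (ZMod p)) - γ.map (Int.castRingHom (ZMod p)) ^ (p ^ f) =
        PowerSeries.X := by
      have sγ : PowerSeries.HasSubst (γ.map (Int.castRingHom (ZMod p))) :=
        hasSubst_of_constantCoeff (by
          rw [← PowerSeries.coeff_zero_eq_constantCoeff_apply, PowerSeries.coeff_map,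
            PowerSeries.coeff_zero_eq_constantCoeff_apply, hγ0, map_zero])
      have h3 := congrArg (PowerSeries.map (Int.castRingHom (ZMod p))) hGγ
      have h4 : (PowerSeries.map (Int.castRingHom (ZMod p))) ((scaledPsi p (p ^ f)).subst γ) =
          ((scaledPsi p (p ^ f)).map (Int.castRingHom (ZMod p))).subst
            (γ.map (Int.castRingHom (ZMod p))) :=
        PowerSeries.map_subst (hasSubst_of_constantCoeff hγ0) _
      rw [h4, map_scaledPsi_zmod hq, PowerSeries.subst_sub sγ, PowerSeries.subst_pow sγ,
        PowerSeries.subst_X sγ, PowerSeries.map_X] at h3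
      exact h3
    obtain ⟨k, hk, hk0⟩ := frequently_coeff_ne_zero hq h2 N
    refine hk0 ?_
    rw [PowerSeries.coeff_map, eq_intCast, ZMod.intCast_zmod_eq_zero_iff_dvd,
      ← norm_intCast_lt_one_iff]
    have h5 := hN k hk
    rw [norm_mul, norm_pow] at h5
    exact (le_mul_of_one_le_right (norm_nonneg _) (one_le_pow₀ hpT1)).trans_lt h5
  · intro hT
    have h1 : Summable fun k : ℕ => ((PowerSeries.coeff k γ : ℤ) : ℂ_[p]) * (p * T) ^ k := by
      refine Summable.of_norm_bounded (g := fun k : ℕ => (‖T‖ / p) ^ k)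
        (summable_geometric_of_lt_one (by positivity) ((div_lt_one hpos).mpr hT)) fun k => ?_
      rw [norm_mul, norm_pow, hpT]
      exact mul_le_of_le_one_left (by positivity) (norm_intCast_le_one _)
    refine (h1.mul_left (p : ℂ_[p])⁻¹).congr fun k => ?_
    rw [← hcoeff, inv_mul_cancel_left₀ hp0]

end Inverse

/-! ### Representatives of the units of `ℤ_q` modulo `p ^ n` -/

section Representatives

variable {p : ℕ} [Fact p.Prime] {f : ℕ}

theorem exists_zero_ball_eq_singleton (hf : 0 < f) {x : ℂ_[p]} (hx : x ∈ Qq p f) :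
    ∃ z ∈ Qq p f, {y ∈ Metric.ball x (p : ℝ) | evalCp (psiCp p f) y = 0} = {z} := by
  obtain ⟨z, hz, hzx, hz0⟩ := exists_zero_near hf hx
  have hzp : ‖z - x‖ < p := hzx.trans_lt one_lt_prime_real
  refine ⟨z, hz, Set.Subset.antisymm ?_ ?_⟩
  · rintro y ⟨hy, hy0⟩
    exact eq_of_zeros_near hf hx (mem_ball_iff_norm.mp hy) hzp hy0 hz0
  · rintro _ rfl
    exact ⟨mem_ball_iff_norm.mpr hzp, hz0⟩

theorem norm_eq_of_norm_sub_lt {n : ℕ} {x z : ℂ_[p]} (hx : ‖x‖ = (p : ℝ) ^ (n + 1))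
    (hz : ‖z - x‖ < p) : ‖z‖ = (p : ℝ) ^ (n + 1) := by
  have h1 : ‖z - x‖ < ‖x‖ := by
    rw [hx]
    exact hz.trans_le (le_self_pow₀ one_lt_prime_real.le (by omega))
  rw [← sub_add_cancel z x, IsUltrametricDist.norm_add_eq_max_of_norm_ne_norm h1.ne,
    max_eq_right h1.le, hx]

theorem norm_eq_one_of_isUnit_mk {n : ℕ} {a : Zq p f}
    (h : IsUnit (Ideal.Quotient.mk (Ideal.span {(p : Zq p f) ^ (n + 1)}) a)) :
    ‖(a : ℂ_[p])‖ = 1 := by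
  obtain ⟨b, hb⟩ := h.exists_right_inv
  obtain ⟨b, rfl⟩ := Ideal.Quotient.mk_surjective b
  rw [← map_mul, ← map_one (Ideal.Quotient.mk _), Ideal.Quotient.eq,
    Ideal.mem_span_singleton] at hb
  obtain ⟨c, hc⟩ := hb
  have h1 : (a : ℂ_[p]) * b = 1 + p ^ (n + 1) * c := by
    have := congrArg (Zq p f).subtype (sub_eq_iff_eq_add'.mp hc)
    simpa using this
  have h2 : ‖(p : ℂ_[p]) ^ (n + 1) * c‖ < ‖(1 : ℂ_[p])‖ := by
    rw [norm_one, norm_mul, norm_pow, norm_natCast_prime]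
    exact mul_lt_one_of_nonneg_of_lt_one_left (by positivity)
      (pow_lt_one₀ (by positivity) prime_inv_lt_one (by omega)) c.2.2
  have h3 : ‖(a : ℂ_[p])‖ * ‖(b : ℂ_[p])‖ = 1 := by
    rw [← norm_mul, h1, IsUltrametricDist.norm_add_eq_max_of_norm_ne_norm h2.ne',
      max_eq_left h2.le, norm_one]
  refine le_antisymm a.2.2 ?_
  rw [← h3]
  exact mul_le_of_le_one_right (norm_nonneg _) b.2.2

theorem mk_eq_mk_of_norm_sub_div_lt (hf : 0 < f) {n : ℕ} {a b : Zq p f}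
    (h : ‖((a : ℂ_[p]) - b) / (p : ℂ_[p]) ^ n‖ < p) :
    Ideal.Quotient.mk (Ideal.span {(p : Zq p f) ^ n}) a =
      Ideal.Quotient.mk (Ideal.span {(p : Zq p f) ^ n}) b := by
  have hpos : (0 : ℝ) < p := zero_lt_one.trans one_lt_prime_real
  set d : ℂ_[p] := ((a : ℂ_[p]) - b) / (p : ℂ_[p]) ^ n with hd
  have hdm : d ∈ Qq p f := div_mem (sub_mem a.2.1 b.2.1) (pow_mem (natCast_mem _ p) n)
  have hd1 : ‖d‖ ≤ 1 := by
    have h1 := norm_le_inv_of_norm_lt_one hf (mul_mem (natCast_mem _ p) hdm) (by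
      rw [norm_mul, norm_natCast_prime, inv_mul_lt_iff₀ hpos, mul_one]
      exact h)
    rwa [norm_mul, norm_natCast_prime, mul_le_iff_le_one_right (by positivity)] at h1
  rw [Ideal.Quotient.eq, Ideal.mem_span_singleton]
  refine ⟨⟨d, hdm, hd1⟩, (Zq p f).subtype_injective ?_⟩
  have hp0 : (p : ℂ_[p]) ^ n ≠ 0 := pow_ne_zero _ natCast_prime_ne_zero
  simp only [map_sub, map_mul, map_pow, map_natCast, Subring.subtype_apply, hd]
  field_simp

theorem ncard_psiZeros_succ (hf : 0 < f) (n : ℕ) :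
    (psiZeros p f (n + 1)).ncard = (p ^ f) ^ (n + 1) - (p ^ f) ^ n := by
  rw [psiZeros_succ hf, Set.ncard_coe_finset, card_zeroFinset, pow_succ, Nat.mul_sub_one]

theorem zeros_of_unitRepresentatives (hf : 0 < f) (n : ℕ)
    {a : Fin ((p ^ f) ^ (n + 1) - (p ^ f) ^ n) → Zq p f}
    (ha : IsUnitRepresentatives p f (n + 1) a) :
    ∃ z : Fin ((p ^ f) ^ (n + 1) - (p ^ f) ^ n) → ℂ_[p],
      (∀ i, {x ∈ Metric.ball ((a i : ℂ_[p]) / (p : ℂ_[p]) ^ (n + 1)) (p : ℝ) |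
        evalCp (psiCp p f) x = 0} = {z i}) ∧
      Function.Injective z ∧ Set.range z = psiZeros p f (n + 1) := by
  have hmem : ∀ i, (a i : ℂ_[p]) / (p : ℂ_[p]) ^ (n + 1) ∈ Qq p f := fun i =>
    div_mem (a i).2.1 (pow_mem (natCast_mem _ p) _)
  choose z _ hz using fun i => exists_zero_ball_eq_singleton hf (hmem i)
  have hzi : ∀ i, z i ∈ {x ∈ Metric.ball ((a i : ℂ_[p]) / (p : ℂ_[p]) ^ (n + 1)) (p : ℝ) |
      evalCp (psiCp p f) x = 0} := fun i => by rw [hz i]; rfl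
  have hinj : Function.Injective z := by
    intro i j hij
    refine ha.injOn (Set.mem_univ i) (Set.mem_univ j) (mk_eq_mk_of_norm_sub_div_lt hf ?_)
    have h1 := mem_ball_iff_norm.mp (hzi i).1
    have h2 := mem_ball_iff_norm.mp (hzi j).1
    rw [hij] at h1
    have h3 : ((a i : ℂ_[p]) - a j) / (p : ℂ_[p]) ^ (n + 1) =
        (z j - a j / (p : ℂ_[p]) ^ (n + 1)) - (z j - a i / (p : ℂ_[p]) ^ (n + 1)) := by ring
    rw [h3]
    exact (norm_sub_le_max' _ _).trans_lt (max_lt h2 h1)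
  refine ⟨z, hz, hinj, ?_⟩
  have hfin : (psiZeros p f (n + 1)).Finite := by
    rw [psiZeros_succ hf]
    exact Finset.finite_toSet _
  refine Set.eq_of_subset_of_ncard_le ?_ ?_ hfin
  · rintro _ ⟨i, rfl⟩
    refine ⟨norm_eq_of_norm_sub_lt ?_ (mem_ball_iff_norm.mp (hzi i).1), (hzi i).2⟩
    rw [norm_div, norm_pow, norm_natCast_prime, norm_eq_one_of_isUnit_mk (ha.mapsTo (Set.mem_univ i)),
      inv_pow, div_inv_eq_mul, one_mul]
  · rw [ncard_psiZeros_succ hf, ← Set.image_univ, Set.ncard_image_of_injective _ hinj,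
      Set.ncard_univ, Nat.card_fin]

theorem map_psi_padic : ((psi p (p ^ f)).map (Int.castRingHom ℚ_[p])).map (algebraMap ℚ_[p] ℂ_[p]) =
    psiCp p f := by
  ext k
  simp [psiCp]

/-! ### The product over all zeros -/

theorem exists_isSchnirelmannProduct (hf : 0 < f) : ∃ P : ℕ+ → ℚ_[p][X],
    (∀ n : ℕ+, (P n).map (algebraMap ℚ_[p] ℂ_[p]) = psiFactor p f n) ∧
      IsSchnirelmannProduct ((psi p (p ^ f)).map (Int.castRingHom ℚ_[p])) 1 1 P
        (fun n => (p : ℝ) ^ (n : ℕ)) := by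
  have hp := one_lt_prime_real (p := p)
  choose P hP using fun n : ℕ => exists_map_eq_zeroFactor (p := p) hf n
  have hcoe : ∀ n : ℕ+, (n : ℕ) = n.natPred + 1 := fun n => n.natPred_add_one.symm
  refine ⟨fun n => P n.natPred, fun n => by rw [hP, hcoe n, psiFactor_succ hf], ?_⟩
  refine ⟨?_, fun n => pow_pos (zero_lt_one.trans hp) _, fun m n hmn => pow_lt_pow_right₀ hp hmn,
    fun n => (isExtremal_of_map_eq_zeroFactor hf (hP _)).1, fun n => ?_, fun R => ?_⟩
  · rw [map_psi_padic]
    exact isEntire_psiCp hf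
  · simp only [hcoe n]
    exact (isExtremal_of_map_eq_zeroFactor hf (hP _)).2
  · rw [map_psi_padic]
    have h1 := tendstoUniformlyOn_prod_zeroFactor (p := p) hf R
    have h2 : Filter.Tendsto (fun s : Finset ℕ+ => s.map ⟨PNat.natPred, PNat.natPred_injective⟩)
        Filter.atTop Filter.atTop := by
      refine Filter.tendsto_atTop_finset_of_monotone (fun s t h => Finset.map_subset_map.mpr h)
        fun k => ⟨{k.succPNat}, by simp⟩
    intro u hu
    filter_upwards [h2.eventually (h1 u hu)] with s hs x hx
    have h3 : ∀ k : ℕ, Polynomial.aeval x (P k) = (zeroFactor p hf k).eval x := fun k => by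
      rw [← hP, Polynomial.eval_map_algebraMap]
    simpa [h3] using hs x hx

end Representatives

theorem mainTheorem1 (p : ℕ) [Fact p.Prime] (f : ℕ) (hf : 0 < f) :
    -- the zeros of the entire function `Ψ_q`, `q = p ^ f`
    (IsEntire (psiCp p f) ∧
      ∀ n : ℕ, 1 ≤ n →
        (psiZeros p f n).ncard = (p ^ f) ^ n - (p ^ f) ^ (n - 1) ∧
        (∀ z ∈ psiZeros p f n, z ∈ Qq p f ∧ IsSimpleZero (psiCp p f) z) ∧
        (∀ a : Zq p f, IsUnit a →
          ∃ z ∈ Qq p f,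
            {x ∈ Metric.ball ((a : ℂ_[p]) / (p : ℂ_[p]) ^ n) (p : ℝ) | evalCp (psiCp p f) x = 0} =
              {z}) ∧
        (∀ a : Fin ((p ^ f) ^ n - (p ^ f) ^ (n - 1)) → Zq p f, IsUnitRepresentatives p f n a →
          ∃ z : Fin ((p ^ f) ^ n - (p ^ f) ^ (n - 1)) → ℂ_[p],
            (∀ i, {x ∈ Metric.ball ((a i : ℂ_[p]) / (p : ℂ_[p]) ^ n) (p : ℝ) |
              evalCp (psiCp p f) x = 0} = {z i}) ∧
            Function.Injective z ∧ Set.range z = psiZeros p f n)) ∧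
    -- the Lazard–Schnirelmann product
    ((∀ n : ℕ, 1 ≤ n → ∃ g : (Zq p f)[X],
        psiFactor p f n =
          1 + Polynomial.C ((p : ℂ_[p]) ^ n) * Polynomial.X * g.map (Zq p f).subtype) ∧
      ∃ P : ℕ+ → ℚ_[p][X],
        (∀ n : ℕ+, (P n).map (algebraMap ℚ_[p] ℂ_[p]) = psiFactor p f n) ∧
        IsSchnirelmannProduct ((psi p (p ^ f)).map (Int.castRingHom ℚ_[p])) 1 1 P
          (fun n => (p : ℝ) ^ (n : ℕ))) ∧
    -- the inverse series and its disc of convergence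
    (∃ β : ℤ⟦X⟧,
      (∀ γ : ℤ⟦X⟧,
        (PowerSeries.constantCoeff γ = 0 ∧
          (psi p (p ^ f)).subst γ = (PowerSeries.X : ℤ⟦X⟧) ∧
          γ.subst (psi p (p ^ f)) = (PowerSeries.X : ℤ⟦X⟧)) ↔ γ = β) ∧
      PowerSeries.constantCoeff β = 0 ∧ PowerSeries.coeff 1 β = 1 ∧
      ∀ T : ℂ_[p],
        (Summable fun k : ℕ => ((PowerSeries.coeff k β : ℤ) : ℂ_[p]) * T ^ k) ↔ ‖T‖ < (p : ℝ)) := by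
  have hq := two_le_prime_pow (p := p) hf
  refine ⟨⟨isEntire_psiCp hf, fun n hn => ?_⟩, ⟨fun n hn => ?_, exists_isSchnirelmannProduct hf⟩, ?_⟩
  · obtain ⟨n, rfl⟩ := Nat.exists_eq_add_of_le' hn
    rw [Nat.add_sub_cancel]
    refine ⟨ncard_psiZeros_succ hf n, fun z hz => ?_, fun a _ => ?_, fun a ha =>
      zeros_of_unitRepresentatives hf n ha⟩
    · rw [psiZeros_succ hf, Finset.mem_coe] at hz
      exact ⟨(of_mem_zeroFinset hf hz).1, isSimpleZero_of_mem_zeroFinset hf hz⟩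
    · exact exists_zero_ball_eq_singleton hf (div_mem a.2.1 (pow_mem (natCast_mem _ p) _))
  · obtain ⟨n, rfl⟩ := Nat.exists_eq_add_of_le' hn
    rw [psiFactor_succ hf]
    exact zeroFactor_eq hf n
  · have hΨ := isPsi_psi (Fact.out : p.Prime).ne_zero hq
    have hΨ0 : PowerSeries.constantCoeff (psi p (p ^ f)) = 0 := by
      rw [← PowerSeries.coeff_zero_eq_constantCoeff_apply, hΨ.1]
    have hu : IsUnit (PowerSeries.coeff 1 (psi p (p ^ f))) := by
      rw [hΨ.2.1]
      exact isUnit_one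
    set β : ℤ⟦X⟧ := (psi p (p ^ f)).substInvOfIsUnit hu with hβ
    have hβ0 : PowerSeries.constantCoeff β = 0 := PowerSeries.constantCoeff_substInvOfIsUnit _ hu
    have hΨβ : (psi p (p ^ f)).subst β = (PowerSeries.X : ℤ⟦X⟧) :=
      PowerSeries.subst_substInvOfIsUnit_right _ hΨ0 hu
    have hβΨ : β.subst (psi p (p ^ f)) = (PowerSeries.X : ℤ⟦X⟧) :=
      PowerSeries.subst_substInvOfIsUnit_left _ hΨ0 hu
    refine ⟨β, fun γ => ⟨?_, ?_⟩, hβ0, ?_, summable_inverse_iff hf hβ0 hΨβ⟩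
    · rintro ⟨hγ0, hΨγ, -⟩
      have sγ := hasSubst_of_constantCoeff hγ0
      have h1 := PowerSeries.subst_comp_subst_apply (hasSubst_of_constantCoeff hΨ0) sγ β
      rw [hβΨ, hΨγ, PowerSeries.subst_X sγ, PowerSeries.X_subst] at h1
      exact h1
    · rintro rfl
      exact ⟨hβ0, hΨβ, hβΨ⟩
    · have h1 := PowerSeries.coeff_one_substInvOfIsUnit (psi p (p ^ f)) hu
      have h2 : hu.unit = 1 := Units.ext hΨ.2.1
      rw [hβ, h1, h2, inv_one, Units.val_one]
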